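/- Let $n\ge 0$ be an integer and $q_0\in\mathbb{C}^\times$. Let $\bar Q$ be the quiver with vertices $0,\infty$ and arrows $x,y:0\to0$, $v:0\to\infty$, $w:\infty\to0$; put $y=x^*$, $x=y^*$, $w=v^*$, $v=w^*$. Let $\mathbb{C}\bar Q$ be its path algebra, with paths composed from left to right and with $e_0,e_\infty$ the trivial paths, and let $A$ be obtained from it by inverting all $1+aa^*$, $a\in\{x,y,v,w\}$. Let $\{\!\{-,-\}\!\}$ be the double quasi-Poisson bracket on $A$ determined by $\{\!\{b,a\}\!\}=-\{\!\{a,b\}\!\}^\circ$, where $(c'\otimes c'')^\circ=c''\otimes c'$, and $$\{\!\{x,x\}\!\}=\tfrac12(x^2\otimes e_0-e_0\otimes x^2),\quad \{\!\{y,y\}\!\}=\tfrac12(e_0\otimes y^2-y^2\otimes e_0),\quad \{\!\{v,v\}\!\}=\{\!\{w,w\}\!\}=0,$$ $$\{\!\{x,y\}\!\}=e_0\otimes e_0+\tfrac12 yx\otimes e_0+\tfrac12 e_0\otimes xy+\tfrac12(y\otimes x-x\otimes y),$$ $$\{\!\{v,w\}\!\}=e_\infty\otimes e_0+\tfrac12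 e_\infty\otimes vw+\tfrac12 wv\otimes e_0,$$ $$\{\!\{a,v\}\!\}=\tfrac12 e_0\otimes av-\tfrac12 a\otimes v,\quad \{\!\{a,w\}\!\}=\tfrac12 wa\otimes e_0-\tfrac12 w\otimes a\qquad(a\in\{x,y\}).$$ Let $\mathrm{Rep}(A,(1,n))$ be the space of representations of $A$ on $\mathbb{C}$ (at $\infty$) and $\mathbb{C}^n$ (at $0$), that is, of quadruples $$X,Y\in\mathrm{Mat}_{n\times n}(\mathbb{C}),\quad V\in\mathrm{Mat}_{n\times1}(\mathbb{C}),\quad W\in\mathrm{Mat}_{1\times n}(\mathbb{C})$$ for which $\mathrm{Id}_n+XY$, $\mathrm{Id}_n+YX$, $\mathrm{Id}_n+VW$ and $1+WV$ are invertible. Its coordinate ring carries the antisymmetric biderivation with $$\{a_{ij},b_{uv}\}=\{\!\{a,b\}\!\}'_{uj}\,\{\!\{a,b\}\!\}''_{iv}$$ for arrows $a,b$, where $a_{ij}$ denotes the matrix entries, on $\mathbb{C}^n\oplus\mathbb{C}$, of the universal representation. Let $\mathrm{Rep}(\Lambda^q,(1,n))\subset\mathrm{Rep}(A,(1,n))$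 be the closed subscheme defined by $$(\mathrm{Id}_n+XY)(\mathrm{Id}_n+YX)^{-1}(\mathrm{Id}_n+VW)=q_0\,\mathrm{Id}_n,\qquad (1+WV)^{-1}=q_0^{-n}.$$ The group $\mathrm{GL}_n(\mathbb{C})$ acts by $g.(X,Y,V,W)=(gXg^{-1},gYg^{-1},gV,Wg^{-1})$. The tadpole Calogero–Moser space is $\mathcal{C}_{n,q_0}=\mathrm{Rep}(\Lambda^q,(1,n))/\!/\mathrm{GL}_n(\mathbb{C})$, so that $\mathcal{O}(\mathcal{C}_{n,q_0})=\mathcal{O}(\mathrm{Rep}(\Lambda^q,(1,n)))^{\mathrm{GL}_n(\mathbb{C})}$. The Poisson bracket of two elements of this ring is the restriction to $\mathrm{Rep}(\Lambda^q,(1,n))$ of the bracket of arbitrary lifts of them to $\mathcal{O}(\mathrm{Rep}(A,(1,n)))$; it does not depend on the lifts and is again invariant. Let $\mathcal{C}^0_{n,q_0}\subset\mathcal{C}_{n,q_0}$ be the open subset on which $X$ is invertible, with its bracket defined in the same way. Then any two functions in the same one of the following families Poisson commute: $$\{\operatorname{tr}X^j\mid j\in\mathbb{N}\},\qquad \{\operatorname{tr}Y^j\mid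 j\in\mathbb{N}\},\qquad \{\operatorname{tr}(\mathrm{Id}_n+XY)^j\mid j\in\mathbb{Z}\}\qquad\text{on }\mathcal{C}_{n,q_0},$$ $$\{\operatorname{tr}(Y+X^{-1})^j\mid j\in\mathbb{Z}\}\qquad\text{on }\mathcal{C}^0_{n,q_0}.$$ -/

import Mathlib

/-!
# The tadpole Calogero-Moser space and its Poisson bracket

The construction proceeds as follows.

* `PathAlg`, `doubleBracket`: path algebra of the double of the tadpole quiver, and Van den Bergh's
  double quasi-Poisson bracket on its arrows.
* `RepRing`, `coord`, `coordBracket`, `repBracket`: the coordinate ring of `Rep(A, (1, n))`, where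
  `A` is the localization of the path algebra at all `1 + aa*`, and the bracket induced on it.
* `momentZero`, `momentInf`, `repIdeal`: the ideal of `Rep(Λ^q, (1, n))`.
* `glAction`, `quotAction`, `CMRing`: the action of `GL_n(ℂ)` and the ring of invariants
  `𝒪(C_{n,q₀})`.
* `poissonBracket`: the induced bracket on `CMRing`. It is well defined because the bracket is
  equivariant (`repBracket_glAction`) and because functions which are invariant on
  `Rep(Λ^q, (1, n))` have brackets with the ideal inside the ideal (`repBracket_mem`); see
  `poissonBracket_mk`.
* `trX`, `trY`, `trOneAddXY`, `trYAddXInv`: the trace functions.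

The parameter `L : Locus` selects the whole space or the open subset on which `X` is invertible.
-/

namespace TadpoleCM

open Matrix TensorProduct

/-! ### The double quiver, its path algebra and the double bracket -/

/-- Generators of the path algebra of the double of the tadpole quiver: the two idempotents
`e₀`, `e_∞` and the arrows `x, y : 0 → 0`, `v : 0 → ∞`, `w : ∞ → 0` (with `y = x*`, `w = v*`). -/
inductive Gen
  | e0 | einf | x | y | v | w

/-- The arrows of the double quiver. -/
inductive Arrow
  | x | y | v | w

/-- The relations of the path algebra. Paths are composed from left to right, so an arrow
`a : i → j` satisfies `e_i a = a = a e_j`. -/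
inductive PathRel : FreeAlgebra ℂ Gen → FreeAlgebra ℂ Gen → Prop
  | unit : PathRel (FreeAlgebra.ι ℂ Gen.e0 + FreeAlgebra.ι ℂ Gen.einf) 1
  | idem0 : PathRel (FreeAlgebra.ι ℂ Gen.e0 * FreeAlgebra.ι ℂ Gen.e0) (FreeAlgebra.ι ℂ Gen.e0)
  | idemInf :
      PathRel (FreeAlgebra.ι ℂ Gen.einf * FreeAlgebra.ι ℂ Gen.einf) (FreeAlgebra.ι ℂ Gen.einf)
  | orth : PathRel (FreeAlgebra.ι ℂ Gen.e0 * FreeAlgebra.ι ℂ Gen.einf) 0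
  | orth' : PathRel (FreeAlgebra.ι ℂ Gen.einf * FreeAlgebra.ι ℂ Gen.e0) 0
  | tail_x : PathRel (FreeAlgebra.ι ℂ Gen.e0 * FreeAlgebra.ι ℂ Gen.x) (FreeAlgebra.ι ℂ Gen.x)
  | head_x : PathRel (FreeAlgebra.ι ℂ Gen.x * FreeAlgebra.ι ℂ Gen.e0) (FreeAlgebra.ι ℂ Gen.x)
  | tail_y : PathRel (FreeAlgebra.ι ℂ Gen.e0 * FreeAlgebra.ι ℂ Gen.y) (FreeAlgebra.ι ℂ Gen.y)
  | head_y : PathRel (FreeAlgebra.ι ℂ Gen.y * FreeAlgebra.ι ℂ Gen.e0) (FreeAlgebra.ι ℂ Gen.y)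
  | tail_v : PathRel (FreeAlgebra.ι ℂ Gen.e0 * FreeAlgebra.ι ℂ Gen.v) (FreeAlgebra.ι ℂ Gen.v)
  | head_v : PathRel (FreeAlgebra.ι ℂ Gen.v * FreeAlgebra.ι ℂ Gen.einf) (FreeAlgebra.ι ℂ Gen.v)
  | tail_w : PathRel (FreeAlgebra.ι ℂ Gen.einf * FreeAlgebra.ι ℂ Gen.w) (FreeAlgebra.ι ℂ Gen.w)
  | head_w : PathRel (FreeAlgebra.ι ℂ Gen.w * FreeAlgebra.ι ℂ Gen.e0) (FreeAlgebra.ι ℂ Gen.w)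

/-- The path algebra of the double of the tadpole quiver. -/
def PathAlg : Type := RingQuot PathRel

noncomputable instance : Ring PathAlg := inferInstanceAs (Ring (RingQuot PathRel))
noncomputable instance : Algebra ℂ PathAlg := inferInstanceAs (Algebra ℂ (RingQuot PathRel))

/-- A generator, as an element of the path algebra. -/
noncomputable def gen (a : Gen) : PathAlg :=
  RingQuot.mkAlgHom ℂ PathRel (FreeAlgebra.ι ℂ a)

/-- The flip `(c' ⊗ c'')° = c'' ⊗ c'`. -/
noncomputable def swapTensor : PathAlg ⊗[ℂ] PathAlg →ₗ[ℂ] PathAlg ⊗[ℂ] PathAlg :=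
  (TensorProduct.comm ℂ PathAlg PathAlg).toLinearMap

/-- `⟪x, y⟫ = e₀ ⊗ e₀ + ½ yx ⊗ e₀ + ½ e₀ ⊗ xy + ½ (y ⊗ x - x ⊗ y)`. -/
noncomputable def dblXY : PathAlg ⊗[ℂ] PathAlg :=
  gen .e0 ⊗ₜ gen .e0 + (1 / 2 : ℂ) • ((gen .y * gen .x) ⊗ₜ gen .e0)
    + (1 / 2 : ℂ) • (gen .e0 ⊗ₜ (gen .x * gen .y))
    + (1 / 2 : ℂ) • (gen .y ⊗ₜ gen .x - gen .x ⊗ₜ gen .y)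

/-- `⟪v, w⟫ = e_∞ ⊗ e₀ + ½ e_∞ ⊗ vw + ½ wv ⊗ e₀`. -/
noncomputable def dblVW : PathAlg ⊗[ℂ] PathAlg :=
  gen .einf ⊗ₜ gen .e0 + (1 / 2 : ℂ) • (gen .einf ⊗ₜ (gen .v * gen .w))
    + (1 / 2 : ℂ) • ((gen .w * gen .v) ⊗ₜ gen .e0)

/-- For `a ∈ {x, y}`: `⟪a, v⟫ = ½ e₀ ⊗ av - ½ a ⊗ v`. -/
noncomputable def dblLoopV (a : Gen) : PathAlg ⊗[ℂ] PathAlg :=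
  (1 / 2 : ℂ) • (gen .e0 ⊗ₜ (gen a * gen .v)) - (1 / 2 : ℂ) • (gen a ⊗ₜ gen .v)

/-- For `a ∈ {x, y}`: `⟪a, w⟫ = ½ wa ⊗ e₀ - ½ w ⊗ a`. -/
noncomputable def dblLoopW (a : Gen) : PathAlg ⊗[ℂ] PathAlg :=
  (1 / 2 : ℂ) • ((gen .w * gen a) ⊗ₜ gen .e0) - (1 / 2 : ℂ) • (gen .w ⊗ₜ gen a)

/-- Van den Bergh's double quasi-Poisson bracket `⟪a, b⟫` on the arrows of the double quiver,
for the ordering `x < y < v < w`; the brackets of arrows in the opposite order are given by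
`⟪b, a⟫ = -⟪a, b⟫°`. -/
noncomputable def doubleBracket : Arrow → Arrow → PathAlg ⊗[ℂ] PathAlg
  | .x, .x => (1 / 2 : ℂ) • ((gen .x * gen .x) ⊗ₜ gen .e0 - gen .e0 ⊗ₜ (gen .x * gen .x))
  | .y, .y => (1 / 2 : ℂ) • (gen .e0 ⊗ₜ (gen .y * gen .y) - (gen .y * gen .y) ⊗ₜ gen .e0)
  | .v, .v => 0
  | .w, .w => 0
  | .x, .y => dblXY
  | .v, .w => dblVW
  | .x, .v => dblLoopV .x
  | .y, .v => dblLoopV .y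
  | .x, .w => dblLoopW .x
  | .y, .w => dblLoopW .y
  | .y, .x => -swapTensor dblXY
  | .w, .v => -swapTensor dblVW
  | .v, .x => -swapTensor (dblLoopV .x)
  | .v, .y => -swapTensor (dblLoopV .y)
  | .w, .x => -swapTensor (dblLoopW .x)
  | .w, .y => -swapTensor (dblLoopW .y)

/-! ### Representation spaces of dimension vector `(1, n)` -/

/-- Coordinates on `Rep(ℂQ̄, (1, n))`: the entries of `X`, `Y`, `V` and `W`. -/
inductive Coord (n : ℕ)
  | X (i j : Fin n)
  | Y (i j : Fin n)
  | V (i : Fin n)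
  | W (j : Fin n)
  deriving DecidableEq, Fintype

/-- Index set of the total space `ℂⁿ ⊕ ℂ`. -/
abbrev Idx (n : ℕ) : Type := Fin n ⊕ Unit

/-- The arrow to which a coordinate belongs. -/
def Coord.arrow {n : ℕ} : Coord n → Arrow
  | .X _ _ => .x
  | .Y _ _ => .y
  | .V _ => .v
  | .W _ => .w

/-- The row of a coordinate, in block matrices indexed by `ℂⁿ ⊕ ℂ`. -/
def Coord.row {n : ℕ} : Coord n → Idx n
  | .X i _ => .inl i
  | .Y i _ => .inl i
  | .V i => .inl i
  | .W _ => .inr ()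

/-- The column of a coordinate, in block matrices indexed by `ℂⁿ ⊕ ℂ`. -/
def Coord.col {n : ℕ} : Coord n → Idx n
  | .X _ j => .inl j
  | .Y _ j => .inl j
  | .V _ => .inr ()
  | .W j => .inl j

section Points

variable {n : ℕ} {S : Type*}

/-- The matrix `X` of a tuple of coordinates. -/
def matX (p : Coord n → S) : Matrix (Fin n) (Fin n) S := Matrix.of fun i j => p (.X i j)
/-- The matrix `Y` of a tuple of coordinates. -/
def matY (p : Coord n → S) : Matrix (Fin n) (Fin n) S := Matrix.of fun i j => p (.Y i j)
/-- The column `V` of a tuple of coordinates. -/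
def matV (p : Coord n → S) : Matrix (Fin n) Unit S := Matrix.of fun i _ => p (.V i)
/-- The row `W` of a tuple of coordinates. -/
def matW (p : Coord n → S) : Matrix Unit (Fin n) S := Matrix.of fun _ j => p (.W j)

/-- The point with given matrices. -/
def point (X Y : Matrix (Fin n) (Fin n) S) (V : Matrix (Fin n) Unit S)
    (W : Matrix Unit (Fin n) S) : Coord n → S
  | .X i j => X i j
  | .Y i j => Y i j
  | .V i => V i ()
  | .W j => W () j

variable [CommRing S]

/-- The block matrix representing a generator of the path algebra. -/
def genMatrix (p : Coord n → S) : Gen → Matrix (Idx n) (Idx n) S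
  | .e0 => Matrix.fromBlocks 1 0 0 0
  | .einf => Matrix.fromBlocks 0 0 0 1
  | .x => Matrix.fromBlocks (matX p) 0 0 0
  | .y => Matrix.fromBlocks (matY p) 0 0 0
  | .v => Matrix.fromBlocks 0 (matV p) 0 0
  | .w => Matrix.fromBlocks 0 0 (matW p) 0

/-- The representation `𝒳` of the path algebra attached to a point. -/
noncomputable def rep [Algebra ℂ S] (p : Coord n → S) :
    PathAlg →ₐ[ℂ] Matrix (Idx n) (Idx n) S :=
  RingQuot.liftAlgHom ℂ ⟨FreeAlgebra.lift ℂ (genMatrix p), by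
    intro a b h
    cases h <;> simp [genMatrix, Matrix.fromBlocks_multiply, Matrix.fromBlocks_add]⟩

/-- The function `(a', a'') ↦ a'_{uj} a''_{iv}` on the tensor square of the path algebra. -/
noncomputable def entryPairing [Algebra ℂ S] (p : Coord n → S) (i j u v : Idx n) :
    PathAlg ⊗[ℂ] PathAlg →ₗ[ℂ] S :=
  LinearMap.mul' ℂ S ∘ₗ TensorProduct.map
    (Matrix.entryLinearMap ℂ S u j ∘ₗ (rep p).toLinearMap)
    (Matrix.entryLinearMap ℂ S i v ∘ₗ (rep p).toLinearMap)

end Points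

/-- The two spaces on which functions are considered: the whole representation space, or its open
subset on which `X` is invertible. -/
inductive Locus
  | whole
  | invX

/-- Coordinate ring of the affine space `Rep(ℂQ̄, (1, n))`. -/
abbrev PolyRing (n : ℕ) : Type := MvPolynomial (Coord n) ℂ

/-- Value at a point of the function to be inverted: `1 + aa*` has to be invertible for every
arrow `a`, and `X` as well on the open subset. -/
noncomputable def denAt {n : ℕ} {S : Type*} [CommRing S] (L : Locus) (p : Coord n → S) : S :=
  (1 + matX p * matY p).det * (1 + matY p * matX p).det * (1 + matV p * matW p).det
    * (1 + matW p * matV p).det *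
    match L with
    | .whole => 1
    | .invX => (matX p).det

/-- The function to be inverted, as a polynomial in the coordinates. -/
noncomputable def den (n : ℕ) (L : Locus) : PolyRing n := denAt L MvPolynomial.X

/-- The coordinate ring `𝒪(Rep(A, (1, n)))`, where `A` is obtained from the path algebra by
inverting all `1 + aa*` (and `x`, on the open subset). -/
def RepRing (n : ℕ) (L : Locus) : Type := Localization.Away (den n L)

section RepRing

variable (n : ℕ) (L : Locus)

noncomputable instance : CommRing (RepRing n L) :=
  inferInstanceAs (CommRing (Localization.Away (den n L)))
noncomputable instance : Algebra (PolyRing n) (RepRing n L) :=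
  inferInstanceAs (Algebra (PolyRing n) (Localization.Away (den n L)))
noncomputable instance : Algebra ℂ (RepRing n L) :=
  inferInstanceAs (Algebra ℂ (Localization.Away (den n L)))
instance : IsScalarTower ℂ (PolyRing n) (RepRing n L) :=
  inferInstanceAs (IsScalarTower ℂ (PolyRing n) (Localization.Away (den n L)))
instance : IsLocalization.Away (den n L) (RepRing n L) :=
  inferInstanceAs (IsLocalization.Away (den n L) (Localization.Away (den n L)))

/-- The coordinate functions on the representation space. -/
noncomputable def coord (c : Coord n) : RepRing n L :=
  algebraMap (PolyRing n) (RepRing n L) (MvPolynomial.X c)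


variable {n L}

theorem matX_map {S T : Type*} (p : Coord n → S) (f : S → T) :
    (matX p).map f = matX (fun c => f (p c)) := rfl
theorem matY_map {S T : Type*} (p : Coord n → S) (f : S → T) :
    (matY p).map f = matY (fun c => f (p c)) := rfl
theorem matV_map {S T : Type*} (p : Coord n → S) (f : S → T) :
    (matV p).map f = matV (fun c => f (p c)) := rfl
theorem matW_map {S T : Type*} (p : Coord n → S) (f : S → T) :
    (matW p).map f = matW (fun c => f (p c)) := rfl

theorem map_denAt {S T : Type*} [CommRing S] [CommRing T] (f : S →+* T) (p : Coord n → S) :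
    f (denAt L p) = denAt L (fun c => f (p c)) := by
  have h : f (1 + matW p * matV p).det =
      (1 + matW (fun c => f (p c)) * matV (fun c => f (p c))).det := by
    rw [RingHom.map_det, RingHom.mapMatrix_apply, Matrix.map_add _ (map_add f), Matrix.map_mul,
      Matrix.map_one _ (map_zero f) (map_one f), matV_map, matW_map]
  cases L <;>
  simp only [denAt, map_mul, h] <;>
  simp [RingHom.map_det, RingHom.mapMatrix_apply, Matrix.map_add, Matrix.map_mul,
    matX_map, matY_map, matV_map, matW_map]

theorem den_eq : den n L = denAt L (MvPolynomial.X : Coord n → PolyRing n) := rfl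

/-- Universal property of `𝒪(Rep)`: the homomorphism given by a point with values in `S`. -/
noncomputable def evalAt {S : Type*} [CommRing S] [Algebra ℂ S] (p : Coord n → S)
    (hp : IsUnit (denAt L p)) : RepRing n L →ₐ[ℂ] S :=
  IsLocalization.liftAlgHom (M := Submonoid.powers (den n L)) (f := MvPolynomial.aeval p) (by
    rintro ⟨_, k, rfl⟩
    have : (MvPolynomial.aeval p : PolyRing n →ₐ[ℂ] S) (den n L) = denAt L p := by
      have := map_denAt (L := L) ((MvPolynomial.aeval p : PolyRing n →ₐ[ℂ] S) : PolyRing n →+* S)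
        (MvPolynomial.X : Coord n → PolyRing n)
      simpa [den_eq] using this
    simpa [this] using hp.pow k)

@[simp] theorem evalAt_coord {S : Type*} [CommRing S] [Algebra ℂ S] (p : Coord n → S)
    (hp : IsUnit (denAt L p)) (c : Coord n) : evalAt p hp (coord n L c) = p c := by
  simp [evalAt, coord]

theorem algHom_ext {S : Type*} [CommRing S] [Algebra ℂ S] {f g : RepRing n L →ₐ[ℂ] S}
    (h : ∀ c, f (coord n L c) = g (coord n L c)) : f = g := by
  apply IsLocalization.algHom_ext (Submonoid.powers (den n L))
  ext c
  exact h c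

theorem isUnit_denAt : IsUnit (denAt L (coord n L)) := by
  have h := map_denAt (L := L) (algebraMap (PolyRing n) (RepRing n L))
    (MvPolynomial.X : Coord n → PolyRing n)
  have h2 : IsUnit (algebraMap (PolyRing n) (RepRing n L) (den n L)) :=
    IsLocalization.Away.algebraMap_isUnit _
  rw [den_eq, h] at h2
  exact h2

open DualNumber in
theorem isUnit_denAt_dual (φ : Coord n → RepRing n L) :
    IsUnit (denAt L fun c => (TrivSqZeroExt.inl (coord n L c) + TrivSqZeroExt.inr (φ c)
      : (RepRing n L)[ε])) := by
  rw [TrivSqZeroExt.isUnit_iff_isUnit_fst]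
  have := map_denAt (L := L) (TrivSqZeroExt.fstHom (RepRing n L) (RepRing n L) (RepRing n L)
    : (RepRing n L)[ε] →+* (RepRing n L))
      (fun c => (TrivSqZeroExt.inl (coord n L c) + TrivSqZeroExt.inr (φ c)
      : (RepRing n L)[ε]))
  simp only [AlgHom.coe_toRingHom, TrivSqZeroExt.fstHom_apply] at this
  rw [this]
  simpa using isUnit_denAt

open DualNumber in
/-- The homomorphism `f ↦ f + ε D f` to the dual numbers, where `D` is the vector field with
components `φ`. -/
noncomputable def dualHom (φ : Coord n → RepRing n L) : RepRing n L →ₐ[ℂ] (RepRing n L)[ε] :=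
  evalAt (fun c => TrivSqZeroExt.inl (coord n L c) + TrivSqZeroExt.inr (φ c))
    (isUnit_denAt_dual φ)

theorem fst_dualHom (φ : Coord n → RepRing n L) (f : RepRing n L) :
    (dualHom φ f).fst = f := by
  have : (TrivSqZeroExt.fstHom ℂ (RepRing n L) (RepRing n L)).comp (dualHom φ)
      = AlgHom.id ℂ _ := by
    apply algHom_ext
    intro c
    simp [dualHom]
  exact DFunLike.congr_fun this f

/-- The vector field (derivation of `𝒪(Rep)`) with prescribed values on the coordinates. -/
noncomputable def vectorField (φ : Coord n → RepRing n L) :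
    Derivation ℂ (RepRing n L) (RepRing n L) :=
  Derivation.mk' ((TrivSqZeroExt.sndHom (RepRing n L) (RepRing n L)).restrictScalars ℂ ∘ₗ
    (dualHom φ).toLinearMap) (by
    intro a b
    simp [fst_dualHom, mul_comm])

@[simp] theorem vectorField_coord (φ : Coord n → RepRing n L) (c : Coord n) :
    vectorField φ (coord n L c) = φ c := by
  simp [vectorField, dualHom]

theorem derivation_ext {M : Type*} [AddCommGroup M] [Module (RepRing n L) M] [Module ℂ M]
    [IsScalarTower ℂ (RepRing n L) M]
    {D₁ D₂ : Derivation ℂ (RepRing n L) M}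
    (h : ∀ c, D₁ (coord n L c) = D₂ (coord n L c)) : D₁ = D₂ := by
  have key : ∀ p : PolyRing n, (D₁ - D₂) (algebraMap _ (RepRing n L) p) = 0 := by
    intro p
    induction p using MvPolynomial.induction_on with
    | C a =>
      have : algebraMap (PolyRing n) (RepRing n L) (MvPolynomial.C a) = algebraMap ℂ _ a := by
        rw [IsScalarTower.algebraMap_apply ℂ (PolyRing n) (RepRing n L)]; rfl
      rw [this, Derivation.map_algebraMap]
    | add p q hp hq => rw [map_add, map_add, hp, hq, add_zero]
    | mul_X p c hp =>
      rw [map_mul, Derivation.leibniz, hp, smul_zero, add_zero]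
      have : (D₁ - D₂) (algebraMap (PolyRing n) (RepRing n L) (MvPolynomial.X c)) = 0 := by
        rw [Derivation.sub_apply, sub_eq_zero]; exact h c
      rw [this, smul_zero]
  ext f
  rw [← sub_eq_zero, ← Derivation.sub_apply]
  obtain ⟨⟨p, s⟩, hs⟩ := IsLocalization.surj (Submonoid.powers (den n L)) f
  have h1 := key p
  rw [← hs, Derivation.leibniz, key, smul_zero, zero_add] at h1
  exact (IsLocalization.map_units (RepRing n L) s).smul_eq_zero.mp h1

/-- The partial derivative along a coordinate. -/
noncomputable def partialD (c : Coord n) : Derivation ℂ (RepRing n L) (RepRing n L) :=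
  vectorField (Pi.single c 1)

/-- The bracket `{a_ij, b_uv} = ⟪a, b⟫'_{uj} ⟪a, b⟫''_{iv}` of two coordinates. -/
noncomputable def coordBracket (c d : Coord n) : RepRing n L :=
  entryPairing (coord n L) c.row c.col d.row d.col (doubleBracket c.arrow d.arrow)

/-- The bracket on `𝒪(Rep)` induced by the double bracket: the biderivation over `ℂ` with
the above values on the coordinates. -/
noncomputable def repBracket (f g : RepRing n L) : RepRing n L :=
  ∑ c, ∑ d, partialD c f * partialD d g * coordBracket c d


section MomentMap

variable {S : Type*} [CommRing S]

/-- The component at the vertex `0` of the multiplicative moment map,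
`(1 + XY) (1 + YX)⁻¹ (1 + VW)`. -/
noncomputable def momentZero (p : Coord n → S) : Matrix (Fin n) (Fin n) S :=
  (1 + matX p * matY p) * (1 + matY p * matX p)⁻¹ * (1 + matV p * matW p)

/-- The component at the vertex `∞` of the multiplicative moment map, `(1 + WV)⁻¹`. -/
noncomputable def momentInf (p : Coord n → S) : Matrix Unit Unit S :=
  (1 + matW p * matV p)⁻¹

end MomentMap

variable (n L) in
/-- The ideal of `Rep(Λ^q, (1, n))` in `Rep(A, (1, n))`, for `q = (q_∞, q₀)` with
`q_∞ = q₀⁻ⁿ`. -/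
noncomputable def repIdeal (q₀ : ℂˣ) : Ideal (RepRing n L) :=
  Ideal.span
    ({f | ∃ i j, f = (momentZero (coord n L) - (q₀ : ℂ) • 1) i j} ∪
      {f | ∃ i j, f = (momentInf (coord n L) - ((q₀⁻¹ ^ n : ℂˣ) : ℂ) • 1) i j})

@[simp] theorem rep_gen {m : ℕ} {S : Type*} [CommRing S] [Algebra ℂ S] (p : Coord m → S)
    (a : Gen) : rep p (gen a) = genMatrix p a := by
  exact (RingQuot.liftAlgHom_mkAlgHom_apply ℂ _ _ _).trans (FreeAlgebra.lift_ι_apply _ _)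

@[simp] theorem entryPairing_tmul {m : ℕ} {S : Type*} [CommRing S] [Algebra ℂ S]
    (p : Coord m → S) (i j u v : Idx m) (a b : PathAlg) :
    entryPairing p i j u v (a ⊗ₜ b) = rep p a u j * rep p b i v := by
  simp [entryPairing]

theorem entryPairing_swap {m : ℕ} {S : Type*} [CommRing S] [Algebra ℂ S] (p : Coord m → S)
    (i j u v : Idx m) (t : PathAlg ⊗[ℂ] PathAlg) :
    entryPairing p i j u v (swapTensor t) = entryPairing p u v i j t := by
  induction t using TensorProduct.induction_on with
  | zero => simp
  | tmul a b => simp [swapTensor, mul_comm]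
  | add a b ha hb => simp [ha, hb]

theorem doubleBracket_swap (a b : Arrow) :
    doubleBracket a b = -swapTensor (doubleBracket b a) := by
  have h : ∀ t, swapTensor (swapTensor t) = t := fun t => by simp [swapTensor]
  cases a <;> cases b <;> simp only [doubleBracket, map_neg, neg_neg, h, map_zero, neg_zero] <;>
    simp [swapTensor, ← smul_neg]

theorem coordBracket_swap (c d : Coord n) :
    (coordBracket c d : RepRing n L) = -coordBracket d c := by
  simp only [coordBracket]
  rw [doubleBracket_swap, map_neg, entryPairing_swap]

/-- The Hamiltonian vector field `{f, -}`. -/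
noncomputable def hamiltonianField (f : RepRing n L) :
    Derivation ℂ (RepRing n L) (RepRing n L) :=
  ∑ c, ∑ d, (partialD c f * coordBracket c d) • partialD d

theorem derivation_sum_apply {ι : Type*} (s : Finset ι)
    (D : ι → Derivation ℂ (RepRing n L) (RepRing n L)) (f : RepRing n L) :
    (∑ i ∈ s, D i) f = ∑ i ∈ s, D i f := by
  classical
  induction s using Finset.induction_on with
  | empty => simp
  | insert i s hi ih => simp [Finset.sum_insert hi, ih]

theorem hamiltonianField_apply (f g : RepRing n L) :
    hamiltonianField f g = repBracket f g := by
  simp only [hamiltonianField, repBracket, derivation_sum_apply, Derivation.smul_apply,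
    smul_eq_mul]
  refine Finset.sum_congr rfl fun c _ => Finset.sum_congr rfl fun d _ => by ring

theorem repBracket_swap (f g : RepRing n L) : repBracket f g = -repBracket g f := by
  simp only [repBracket]
  rw [Finset.sum_comm, ← Finset.sum_neg_distrib]
  refine Finset.sum_congr rfl fun c _ => ?_
  rw [← Finset.sum_neg_distrib]
  refine Finset.sum_congr rfl fun d _ => ?_
  rw [coordBracket_swap]; ring

@[simp] theorem repBracket_coord (c d : Coord n) :
    repBracket (coord n L c) (coord n L d) = coordBracket c d := by
  simp [repBracket, partialD, Pi.single_apply]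

section Formulas

set_option linter.unusedSimpArgs false

local notation "𝐗" => matX (coord n L)
local notation "𝐘" => matY (coord n L)
local notation "𝐕" => matV (coord n L)
local notation "𝐖" => matW (coord n L)
local notation "𝟏" => (1 : Matrix (Fin n) (Fin n) (RepRing n L))
local notation "𝟙" => (1 : Matrix Unit Unit (RepRing n L))

theorem mul_single_mul {R : Type*} [CommRing R] {a b c d : Type*} [Fintype b] [Fintype c]
    [DecidableEq b] [DecidableEq c]
    (P : Matrix a b R) (Q : Matrix c d R) (j : b) (i : c) (u : a) (v : d) :
    (P * (Matrix.single j i 1 : Matrix b c R) * Q) u v = P u j * Q i v := by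
  rw [Matrix.mul_apply, Finset.sum_eq_single i]
  · simp
  · intro k _ hk
    simp [Matrix.mul_single_apply_of_ne, hk]
  · simp

theorem bracket_X (i j : Fin n) (E : Matrix (Fin n) (Fin n) (RepRing n L))
    (hE : E = Matrix.single j i 1) :
    (𝐗).map (hamiltonianField (coord n L (.X i j))) =
      (1 / 2 : ℂ) • (𝐗 * 𝐗 * E * 𝟏 - 𝟏 * E * (𝐗 * 𝐗)) ∧
    (𝐘).map (hamiltonianField (coord n L (.X i j))) =
      𝟏 * E * 𝟏 + (1 / 2 : ℂ) • (𝐘 * 𝐗 * E * 𝟏) + (1 / 2 : ℂ) • (𝟏 * E * (𝐗 * 𝐘)) + (1 / 2 : ℂ) • (𝐘 * E * 𝐗 - 𝐗 * E * 𝐘) ∧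
    (𝐕).map (hamiltonianField (coord n L (.X i j))) =
      (1 / 2 : ℂ) • (𝟏 * E * (𝐗 * 𝐕)) - (1 / 2 : ℂ) • (𝐗 * E * 𝐕) ∧
    (𝐖).map (hamiltonianField (coord n L (.X i j))) =
      (1 / 2 : ℂ) • (𝐖 * 𝐗 * E * 𝟏) - (1 / 2 : ℂ) • (𝐖 * E * 𝐗) := by
  refine ⟨?_, ?_, ?_, ?_⟩ <;>
  · ext u v
    simp only [Matrix.map_apply, Matrix.smul_apply, Matrix.sub_apply, Matrix.add_apply,
      Matrix.neg_apply, hE, mul_single_mul]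
    simp [hamiltonianField_apply, matX, matY, matV, matW, coordBracket, doubleBracket,
      dblXY, dblVW, dblLoopV, dblLoopW, swapTensor, Coord.row, Coord.col,
      Coord.arrow, genMatrix, Matrix.fromBlocks_multiply]

theorem bracket_Y (i j : Fin n) (E : Matrix (Fin n) (Fin n) (RepRing n L))
    (hE : E = Matrix.single j i 1) :
    (𝐗).map (hamiltonianField (coord n L (.Y i j))) =
      -(𝟏 * E * 𝟏 + (1 / 2 : ℂ) • (𝟏 * E * (𝐘 * 𝐗)) + (1 / 2 : ℂ) • (𝐗 * 𝐘 * E * 𝟏) + (1 / 2 : ℂ) • (𝐗 * E * 𝐘 - 𝐘 * E * 𝐗)) ∧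
    (𝐘).map (hamiltonianField (coord n L (.Y i j))) =
      (1 / 2 : ℂ) • (𝟏 * E * (𝐘 * 𝐘) - 𝐘 * 𝐘 * E * 𝟏) ∧
    (𝐕).map (hamiltonianField (coord n L (.Y i j))) =
      (1 / 2 : ℂ) • (𝟏 * E * (𝐘 * 𝐕)) - (1 / 2 : ℂ) • (𝐘 * E * 𝐕) ∧
    (𝐖).map (hamiltonianField (coord n L (.Y i j))) =
      (1 / 2 : ℂ) • (𝐖 * 𝐘 * E * 𝟏) - (1 / 2 : ℂ) • (𝐖 * E * 𝐘) := by
  refine ⟨?_, ?_, ?_, ?_⟩ <;>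
  · ext u v
    simp only [Matrix.map_apply, Matrix.smul_apply, Matrix.sub_apply, Matrix.add_apply,
      Matrix.neg_apply, hE, mul_single_mul]
    simp [hamiltonianField_apply, matX, matY, matV, matW, coordBracket, doubleBracket,
      dblXY, dblVW, dblLoopV, dblLoopW, swapTensor, Coord.row, Coord.col,
      Coord.arrow, genMatrix, Matrix.fromBlocks_multiply]

theorem bracket_V (i : Fin n) (E : Matrix Unit (Fin n) (RepRing n L))
    (hE : E = Matrix.single () i 1) :
    (𝐗).map (hamiltonianField (coord n L (.V i))) =
      -((1 / 2 : ℂ) • (𝐗 * 𝐕 * E * 𝟏) - (1 / 2 : ℂ) • (𝐕 * E * 𝐗)) ∧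
    (𝐘).map (hamiltonianField (coord n L (.V i))) =
      -((1 / 2 : ℂ) • (𝐘 * 𝐕 * E * 𝟏) - (1 / 2 : ℂ) • (𝐕 * E * 𝐘)) ∧
    (𝐕).map (hamiltonianField (coord n L (.V i))) =
      0 ∧
    (𝐖).map (hamiltonianField (coord n L (.V i))) =
      𝟙 * E * 𝟏 + (1 / 2 : ℂ) • (𝟙 * E * (𝐕 * 𝐖)) + (1 / 2 : ℂ) • (𝐖 * 𝐕 * E * 𝟏) := by
  refine ⟨?_, ?_, ?_, ?_⟩ <;>
  · ext u v
    simp only [Matrix.map_apply, Matrix.smul_apply, Matrix.sub_apply, Matrix.add_apply,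
      Matrix.neg_apply, hE, mul_single_mul]
    simp [hamiltonianField_apply, matX, matY, matV, matW, coordBracket, doubleBracket,
      dblXY, dblVW, dblLoopV, dblLoopW, swapTensor, Coord.row, Coord.col,
      Coord.arrow, genMatrix, Matrix.fromBlocks_multiply]

theorem bracket_W (j : Fin n) (E : Matrix (Fin n) Unit (RepRing n L))
    (hE : E = Matrix.single j () 1) :
    (𝐗).map (hamiltonianField (coord n L (.W j))) =
      -((1 / 2 : ℂ) • (𝟏 * E * (𝐖 * 𝐗)) - (1 / 2 : ℂ) • (𝐗 * E * 𝐖)) ∧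
    (𝐘).map (hamiltonianField (coord n L (.W j))) =
      -((1 / 2 : ℂ) • (𝟏 * E * (𝐖 * 𝐘)) - (1 / 2 : ℂ) • (𝐘 * E * 𝐖)) ∧
    (𝐕).map (hamiltonianField (coord n L (.W j))) =
      -(𝟏 * E * 𝟙 + (1 / 2 : ℂ) • (𝐕 * 𝐖 * E * 𝟙) + (1 / 2 : ℂ) • (𝟏 * E * (𝐖 * 𝐕))) ∧
    (𝐖).map (hamiltonianField (coord n L (.W j))) =
      0 := by
  refine ⟨?_, ?_, ?_, ?_⟩ <;>
  · ext u v
    simp only [Matrix.map_apply, Matrix.smul_apply, Matrix.sub_apply, Matrix.add_apply,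
      Matrix.neg_apply, hE, mul_single_mul]
    simp [hamiltonianField_apply, matX, matY, matV, matW, coordBracket, doubleBracket,
      dblXY, dblVW, dblLoopV, dblLoopW, swapTensor, Coord.row, Coord.col,
      Coord.arrow, genMatrix, Matrix.fromBlocks_multiply]

end Formulas

section Moment

theorem map_mul_derivation {R : Type*} [CommRing R] [Algebra ℂ R] (D : Derivation ℂ R R)
    {a b c : Type*} [Fintype b] (A : Matrix a b R) (B : Matrix b c R) :
    (A * B).map D = A.map D * B + A * B.map D := by
  ext i j
  simp only [Matrix.map_apply, Matrix.mul_apply, Matrix.add_apply, map_sum, Derivation.leibniz,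
    smul_eq_mul, ← Finset.sum_add_distrib]
  exact Finset.sum_congr rfl fun k _ => by ring

theorem map_one_add_derivation {R : Type*} [CommRing R] [Algebra ℂ R] (D : Derivation ℂ R R)
    {a : Type*} [DecidableEq a] (A : Matrix a a R) : (1 + A).map D = A.map D := by
  ext i j
  by_cases h : i = j <;> simp [h]

theorem map_inv_derivation {R : Type*} [CommRing R] [Algebra ℂ R] (D : Derivation ℂ R R)
    {a : Type*} [Fintype a] [DecidableEq a] (A : Matrix a a R) (hA : IsUnit A.det) :
    (A⁻¹).map D = -(A⁻¹ * A.map D * A⁻¹) := by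
  have h := map_mul_derivation D A⁻¹ A
  rw [Matrix.nonsing_inv_mul _ hA] at h
  have h0 : (1 : Matrix a a R).map D = 0 := by
    ext i j
    by_cases h : i = j <;> simp [h]
  rw [h0] at h
  have h2 : (A⁻¹).map D * A = -(A⁻¹ * A.map D) := (neg_eq_of_add_eq_zero_left h.symm).symm
  calc (A⁻¹).map D = (A⁻¹).map D * A * A⁻¹ := by
        rw [Matrix.mul_assoc, Matrix.mul_nonsing_inv _ hA, Matrix.mul_one]
    _ = _ := by rw [h2, Matrix.neg_mul]

theorem moment_identity_loop {M : Type*} [Ring M] [Algebra ℂ M] (A B D C F dA dB dC : M)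
    (h1 : B * D = 1) (h2 : D * B = 1) (G : M)
    (hA : dA = (1 / 2 : ℂ) • (A * F + A * G + F * A - G * A))
    (hB : dB = (1 / 2 : ℂ) • (B * G + G * B - F * B + B * F))
    (hC : dC = (1 / 2 : ℂ) • (G * C - F * C + C * F - C * G)) :
    (dA * D + A * -(D * dB * D)) * C + A * D * dC =
      (1 / 2 : ℂ) • (F * (A * D * C) - G * (A * D * C) + A * D * C * F - A * D * C * G) := by
  have h3 : D * dB * D = (1 / 2 : ℂ) • (G * D + D * G - D * F + F * D) := by
    have e1 : ∀ z, D * (B * z) = z := fun z => by rw [← mul_assoc, h2, one_mul]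
    rw [hB]
    simp only [mul_add, add_mul, mul_sub, sub_mul, smul_mul_assoc, mul_smul_comm, mul_assoc, e1,
      h1, mul_one]
  rw [h3, hA, hC]
  simp only [mul_add, add_mul, mul_sub, sub_mul, smul_mul_assoc, mul_smul_comm, mul_assoc,
    mul_neg, neg_mul]
  module

theorem moment_identity_frame {M : Type*} [Ring M] [Algebra ℂ M] (A B D C U dA dB dC : M)
    (h1 : B * D = 1) (h2 : D * B = 1)
    (hA : dA = (1 / 2 : ℂ) • (U * A - A * U))
    (hB : dB = (1 / 2 : ℂ) • (U * B - B * U))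
    (hC : dC = (1 / 2 : ℂ) • (U * C + C * U)) :
    (dA * D + A * -(D * dB * D)) * C + A * D * dC =
      (1 / 2 : ℂ) • (U * (A * D * C) + A * D * C * U) := by
  have h3 : D * dB * D = (1 / 2 : ℂ) • (D * U - U * D) := by
    have e1 : ∀ z, D * (B * z) = z := fun z => by rw [← mul_assoc, h2, one_mul]
    rw [hB]
    simp only [mul_sub, sub_mul, smul_mul_assoc, mul_smul_comm, mul_assoc, e1, h1, mul_one]
  rw [h3, hA, hC]
  simp only [mul_add, add_mul, mul_sub, sub_mul, smul_mul_assoc, mul_smul_comm, mul_assoc,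
    mul_neg, neg_mul]
  module

set_option linter.unusedSimpArgs false

local notation "𝐗" => matX (coord n L)
local notation "𝐘" => matY (coord n L)
local notation "𝐕" => matV (coord n L)
local notation "𝐖" => matW (coord n L)

theorem moment_identity_loop' {M : Type*} [Ring M] [Algebra ℂ M] (A B D C F dA dB dC : M)
    (h1 : B * D = 1) (h2 : D * B = 1) (G : M)
    (hA : dA = (1 / 2 : ℂ) • (F * A - G * A - A * G - A * F))
    (hB : dB = (1 / 2 : ℂ) • (G * B - F * B - B * F - B * G))
    (hC : dC = (1 / 2 : ℂ) • (G * C - F * C + C * F - C * G)) :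
    (dA * D + A * -(D * dB * D)) * C + A * D * dC =
      (1 / 2 : ℂ) • (F * (A * D * C) - G * (A * D * C) + A * D * C * F - A * D * C * G) := by
  have h3 : D * dB * D = (1 / 2 : ℂ) • (D * G - D * F - F * D - G * D) := by
    have e1 : ∀ z, D * (B * z) = z := fun z => by rw [← mul_assoc, h2, one_mul]
    rw [hB]
    simp only [mul_sub, sub_mul, smul_mul_assoc, mul_smul_comm, mul_assoc, e1, h1, mul_one]
  rw [h3, hA, hC]
  simp only [mul_add, add_mul, mul_sub, sub_mul, smul_mul_assoc, mul_smul_comm, mul_assoc,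
    mul_neg, neg_mul]
  module

theorem isUnit_factors : IsUnit (1 + 𝐗 * 𝐘).det ∧ IsUnit (1 + 𝐘 * 𝐗).det ∧
    IsUnit (1 + 𝐕 * 𝐖).det ∧ IsUnit (1 + 𝐖 * 𝐕).det := by
  have h := isUnit_denAt (n := n) (L := L)
  simp only [denAt, IsUnit.mul_iff] at h
  exact ⟨h.1.1.1.1, h.1.1.1.2, h.1.1.2, h.1.2⟩

theorem map_momentZero (D : Derivation ℂ (RepRing n L) (RepRing n L)) :
    (momentZero (coord n L)).map D =
      (((𝐗).map D * 𝐘 + 𝐗 * (𝐘).map D) * (1 + 𝐘 * 𝐗)⁻¹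
        + (1 + 𝐗 * 𝐘) * -((1 + 𝐘 * 𝐗)⁻¹ * ((𝐘).map D * 𝐗 + 𝐘 * (𝐗).map D) * (1 + 𝐘 * 𝐗)⁻¹))
          * (1 + 𝐕 * 𝐖) +
        (1 + 𝐗 * 𝐘) * (1 + 𝐘 * 𝐗)⁻¹ * ((𝐕).map D * 𝐖 + 𝐕 * (𝐖).map D) := by
  rw [momentZero, map_mul_derivation, map_mul_derivation, map_one_add_derivation,
    map_one_add_derivation, map_inv_derivation _ _ isUnit_factors.2.1, map_one_add_derivation]
  simp only [map_mul_derivation]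

theorem map_momentInf (D : Derivation ℂ (RepRing n L) (RepRing n L)) :
    (momentInf (coord n L)).map D =
      -((1 + 𝐖 * 𝐕)⁻¹ * ((𝐖).map D * 𝐕 + 𝐖 * (𝐕).map D) * (1 + 𝐖 * 𝐕)⁻¹) := by
  rw [momentInf, map_inv_derivation _ _ isUnit_factors.2.2.2, map_one_add_derivation,
    map_mul_derivation]

theorem inv_mul_factors : (1 + 𝐘 * 𝐗) * (1 + 𝐘 * 𝐗)⁻¹ = 1 ∧ (1 + 𝐘 * 𝐗)⁻¹ * (1 + 𝐘 * 𝐗) = 1 :=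
  ⟨Matrix.mul_nonsing_inv _ isUnit_factors.2.1, Matrix.nonsing_inv_mul _ isUnit_factors.2.1⟩

theorem inv_mul_factors' :
    (1 + 𝐖 * 𝐕) * (1 + 𝐖 * 𝐕)⁻¹ = 1 ∧ (1 + 𝐖 * 𝐕)⁻¹ * (1 + 𝐖 * 𝐕) = 1 :=
  ⟨Matrix.mul_nonsing_inv _ isUnit_factors.2.2.2, Matrix.nonsing_inv_mul _ isUnit_factors.2.2.2⟩

theorem momentZero_X (i j : Fin n) (E : Matrix (Fin n) (Fin n) (RepRing n L))
    (hE : E = Matrix.single j i 1) :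
    (momentZero (coord n L)).map (hamiltonianField (coord n L (.X i j))) =
      (1 / 2 : ℂ) • (𝐗 * E * momentZero (coord n L) - E * 𝐗 * momentZero (coord n L)
        + momentZero (coord n L) * (𝐗 * E) - momentZero (coord n L) * (E * 𝐗)) := by
  obtain ⟨hX, hY, hV, hW⟩ := bracket_X (L := L) i j E hE
  rw [map_momentZero, hX, hY, hV, hW]
  apply moment_identity_loop _ _ _ _ _ _ _ _ inv_mul_factors.1 inv_mul_factors.2 <;>
  · simp only [Matrix.mul_add, Matrix.add_mul, Matrix.mul_sub, Matrix.sub_mul, Matrix.smul_mul,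
      Matrix.mul_smul, Matrix.mul_assoc, Matrix.one_mul, Matrix.mul_one, Matrix.mul_neg,
      Matrix.neg_mul]
    module

theorem momentZero_Y (i j : Fin n) (E : Matrix (Fin n) (Fin n) (RepRing n L))
    (hE : E = Matrix.single j i 1) :
    (momentZero (coord n L)).map (hamiltonianField (coord n L (.Y i j))) =
      (1 / 2 : ℂ) • (𝐘 * E * momentZero (coord n L) - E * 𝐘 * momentZero (coord n L)
        + momentZero (coord n L) * (𝐘 * E) - momentZero (coord n L) * (E * 𝐘)) := by
  obtain ⟨hX, hY, hV, hW⟩ := bracket_Y (L := L) i j E hE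
  rw [map_momentZero, hX, hY, hV, hW]
  apply moment_identity_loop' _ _ _ _ _ _ _ _ inv_mul_factors.1 inv_mul_factors.2 <;>
  · simp only [Matrix.mul_add, Matrix.add_mul, Matrix.mul_sub, Matrix.sub_mul, Matrix.smul_mul,
      Matrix.mul_smul, Matrix.mul_assoc, Matrix.one_mul, Matrix.mul_one, Matrix.mul_neg,
      Matrix.neg_mul]
    module

theorem momentZero_V (i : Fin n) (E : Matrix Unit (Fin n) (RepRing n L))
    (hE : E = Matrix.single () i 1) :
    (momentZero (coord n L)).map (hamiltonianField (coord n L (.V i))) =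
      (1 / 2 : ℂ) • (𝐕 * E * momentZero (coord n L) + momentZero (coord n L) * (𝐕 * E)) := by
  obtain ⟨hX, hY, hV, hW⟩ := bracket_V (L := L) i E hE
  rw [map_momentZero, hX, hY, hV, hW]
  apply moment_identity_frame _ _ _ _ _ _ _ _ inv_mul_factors.1 inv_mul_factors.2 <;>
  · simp only [Matrix.mul_add, Matrix.add_mul, Matrix.mul_sub, Matrix.sub_mul, Matrix.smul_mul,
      Matrix.mul_smul, Matrix.mul_assoc, Matrix.one_mul, Matrix.mul_one, Matrix.mul_neg,
      Matrix.neg_mul, Matrix.zero_mul, Matrix.mul_zero]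
    module

theorem momentZero_W (j : Fin n) (E : Matrix (Fin n) Unit (RepRing n L))
    (hE : E = Matrix.single j () 1) :
    (momentZero (coord n L)).map (hamiltonianField (coord n L (.W j))) =
      (1 / 2 : ℂ) • (-(E * 𝐖) * momentZero (coord n L) + momentZero (coord n L) * -(E * 𝐖)) := by
  obtain ⟨hX, hY, hV, hW⟩ := bracket_W (L := L) j E hE
  rw [map_momentZero, hX, hY, hV, hW]
  apply moment_identity_frame _ _ _ _ _ _ _ _ inv_mul_factors.1 inv_mul_factors.2 <;>
  · simp only [Matrix.mul_add, Matrix.add_mul, Matrix.mul_sub, Matrix.sub_mul, Matrix.smul_mul,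
      Matrix.mul_smul, Matrix.mul_assoc, Matrix.one_mul, Matrix.mul_one, Matrix.mul_neg,
      Matrix.neg_mul, Matrix.zero_mul, Matrix.mul_zero]
    module

theorem momentInf_X (i j : Fin n) :
    (momentInf (coord n L)).map (hamiltonianField (coord n L (.X i j))) = 0 := by
  obtain ⟨hX, hY, hV, hW⟩ := bracket_X (L := L) i j _ rfl
  rw [map_momentInf, hV, hW]
  simp only [Matrix.mul_add, Matrix.add_mul, Matrix.mul_sub, Matrix.sub_mul, Matrix.smul_mul,
      Matrix.mul_smul, Matrix.mul_assoc, Matrix.one_mul, Matrix.mul_one, Matrix.mul_neg,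
      Matrix.neg_mul, Matrix.zero_mul, Matrix.mul_zero]
  module

theorem momentInf_Y (i j : Fin n) :
    (momentInf (coord n L)).map (hamiltonianField (coord n L (.Y i j))) = 0 := by
  obtain ⟨hX, hY, hV, hW⟩ := bracket_Y (L := L) i j _ rfl
  rw [map_momentInf, hV, hW]
  simp only [Matrix.mul_add, Matrix.add_mul, Matrix.mul_sub, Matrix.sub_mul, Matrix.smul_mul,
      Matrix.mul_smul, Matrix.mul_assoc, Matrix.one_mul, Matrix.mul_one, Matrix.mul_neg,
      Matrix.neg_mul, Matrix.zero_mul, Matrix.mul_zero]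
  module

theorem frame_inverse {M : Type*} [Ring M] [Algebra ℂ M] (s r U d : M) (h1 : s * r = 1)
    (h2 : r * s = 1) (hd : d = (1 / 2 : ℂ) • (U * s + s * U)) :
    -(r * d * r) = -((1 / 2 : ℂ) • (r * U + U * r)) := by
  have e1 : ∀ z, r * (s * z) = z := fun z => by rw [← mul_assoc, h2, one_mul]
  rw [hd]
  simp only [mul_add, add_mul, smul_mul_assoc, mul_smul_comm, mul_assoc, e1, h1, mul_one]

theorem momentInf_V (i : Fin n) (E : Matrix Unit (Fin n) (RepRing n L))
    (hE : E = Matrix.single () i 1) :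
    (momentInf (coord n L)).map (hamiltonianField (coord n L (.V i))) =
      -((1 / 2 : ℂ) • (momentInf (coord n L) * (E * 𝐕) + E * 𝐕 * momentInf (coord n L))) := by
  obtain ⟨hX, hY, hV, hW⟩ := bracket_V (L := L) i E hE
  rw [map_momentInf, hV, hW]
  apply frame_inverse _ _ _ _ inv_mul_factors'.1 inv_mul_factors'.2
  simp only [Matrix.mul_add, Matrix.add_mul, Matrix.mul_sub, Matrix.sub_mul, Matrix.smul_mul,
      Matrix.mul_smul, Matrix.mul_assoc, Matrix.one_mul, Matrix.mul_one, Matrix.mul_neg,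
      Matrix.neg_mul, Matrix.zero_mul, Matrix.mul_zero]
  module

theorem momentInf_W (j : Fin n) (E : Matrix (Fin n) Unit (RepRing n L))
    (hE : E = Matrix.single j () 1) :
    (momentInf (coord n L)).map (hamiltonianField (coord n L (.W j))) =
      -((1 / 2 : ℂ) • (momentInf (coord n L) * -(𝐖 * E) + -(𝐖 * E) * momentInf (coord n L))) := by
  obtain ⟨hX, hY, hV, hW⟩ := bracket_W (L := L) j E hE
  rw [map_momentInf, hV, hW]
  apply frame_inverse _ _ _ _ inv_mul_factors'.1 inv_mul_factors'.2
  simp only [Matrix.mul_add, Matrix.add_mul, Matrix.mul_sub, Matrix.sub_mul, Matrix.smul_mul,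
      Matrix.mul_smul, Matrix.mul_assoc, Matrix.one_mul, Matrix.mul_one, Matrix.mul_neg,
      Matrix.neg_mul, Matrix.zero_mul, Matrix.mul_zero]
  module

end Moment

section Moment

local notation "𝐗" => matX (coord n L)
local notation "𝐘" => matY (coord n L)
local notation "𝐕" => matV (coord n L)
local notation "𝐖" => matW (coord n L)

variable (n L) in
/-- The vector field of the infinitesimal action of a matrix `E`. -/
noncomputable def actionField (E : Matrix (Fin n) (Fin n) (RepRing n L)) :
    Derivation ℂ (RepRing n L) (RepRing n L) :=
  vectorField (point (E * 𝐗 - 𝐗 * E) (E * 𝐘 - 𝐘 * E) (E * 𝐕) (-(𝐖 * E)))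

theorem mk_momentZero (q₀ : ℂˣ) (i j : Fin n) :
    Ideal.Quotient.mk (repIdeal n L q₀) (momentZero (coord n L) i j)
      = if i = j then algebraMap ℂ _ (q₀ : ℂ) else 0 := by
  have h : momentZero (coord n L) i j - ((q₀ : ℂ) • (1 : Matrix _ _ (RepRing n L))) i j
      ∈ repIdeal n L q₀ :=
    Ideal.subset_span (Or.inl ⟨i, j, rfl⟩)
  rw [Ideal.Quotient.eq.mpr h]
  by_cases hij : i = j
  · subst hij
    simp [Algebra.smul_def]
  · simp [hij]

theorem mk_momentInf (q₀ : ℂˣ) :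
    Ideal.Quotient.mk (repIdeal n L q₀) (momentInf (coord n L) () ())
      = algebraMap ℂ _ ((q₀⁻¹ ^ n : ℂˣ) : ℂ) := by
  have h : momentInf (coord n L) () () -
      (((q₀⁻¹ ^ n : ℂˣ) : ℂ) • (1 : Matrix _ _ (RepRing n L))) () ()
      ∈ repIdeal n L q₀ :=
    Ideal.subset_span (Or.inr ⟨(), (), rfl⟩)
  rw [Ideal.Quotient.eq.mpr h]
  simp [Algebra.smul_def]

/-- Reduction of a derivation modulo an ideal. -/
noncomputable def reduceD (I : Ideal (RepRing n L))
    (D : Derivation ℂ (RepRing n L) (RepRing n L)) : Derivation ℂ (RepRing n L) (RepRing n L ⧸ I) :=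
  (Algebra.linearMap (RepRing n L) (RepRing n L ⧸ I)).compDer D

theorem reduceD_apply (I : Ideal (RepRing n L))
    (D : Derivation ℂ (RepRing n L) (RepRing n L)) (f : RepRing n L) :
    reduceD I D f = Ideal.Quotient.mk I (D f) := rfl

theorem map_mk_momentZero (q₀ : ℂˣ) :
    (momentZero (coord n L)).map (Ideal.Quotient.mk (repIdeal n L q₀)) = (q₀ : ℂ) • 1 := by
  ext i j
  rw [Matrix.map_apply, mk_momentZero]
  by_cases hij : i = j
  · subst hij
    simp [Algebra.smul_def]
  · simp [hij]

theorem map_mk_momentInf (q₀ : ℂˣ) :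
    (momentInf (coord n L)).map (Ideal.Quotient.mk (repIdeal n L q₀)) =
      ((q₀⁻¹ ^ n : ℂˣ) : ℂ) • 1 := by
  ext i j
  rw [Matrix.map_apply, mk_momentInf]
  simp [Algebra.smul_def]

theorem map_mk_smul {a b : Type*} (I : Ideal (RepRing n L)) (z : ℂ)
    (M : Matrix a b (RepRing n L)) :
    (z • M).map (Ideal.Quotient.mk I) = z • M.map (Ideal.Quotient.mk I) := by
  ext i j
  simp only [Matrix.map_apply, Matrix.smul_apply]
  exact map_smul (Ideal.Quotient.mkₐ ℂ I) z (M i j)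

theorem mk_loop_entry (q₀ : ℂˣ) (i j k l : Fin n) (A : Matrix (Fin n) (Fin n) (RepRing n L)) :
    Ideal.Quotient.mk (repIdeal n L q₀) (((1 / 2 : ℂ) • (A * Matrix.single j i 1 *
        momentZero (coord n L) - Matrix.single j i 1 * A * momentZero (coord n L)
        + momentZero (coord n L) * (A * Matrix.single j i 1)
        - momentZero (coord n L) * (Matrix.single j i 1 * A)) :
        Matrix (Fin n) (Fin n) (RepRing n L)) k l) =
      algebraMap ℂ _ (q₀ : ℂ) * Ideal.Quotient.mk (repIdeal n L q₀)
        ((Matrix.single l k 1 * A - A * Matrix.single l k 1 :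
          Matrix (Fin n) (Fin n) (RepRing n L)) i j) := by
  rw [← Matrix.map_apply (f := Ideal.Quotient.mk (repIdeal n L q₀)), map_mk_smul]
  simp only [Matrix.map_sub _ (map_sub _), Matrix.map_add _ (map_add _), Matrix.map_mul,
    map_mk_momentZero, Matrix.mul_smul, Matrix.smul_mul, Matrix.mul_one, Matrix.one_mul]
  rw [show ∀ a b : Matrix (Fin n) (Fin n) (RepRing n L ⧸ repIdeal n L q₀),
    (1 / 2 : ℂ) • ((q₀ : ℂ) • a - (q₀ : ℂ) • b + (q₀ : ℂ) • a - (q₀ : ℂ) • b) =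
      (q₀ : ℂ) • (a - b) from fun a b => by module]
  rw [← Matrix.map_mul, ← Matrix.map_mul, ← Matrix.map_sub _ (map_sub _), Matrix.smul_apply,
    Matrix.map_apply, Algebra.smul_def]
  congr 2
  simp only [Matrix.sub_apply, Matrix.mul_apply, Matrix.single_apply, ite_and, mul_ite, ite_mul,
    mul_one, one_mul, mul_zero, zero_mul, Finset.sum_ite_eq, Finset.sum_ite_irrel,
    Finset.sum_const_zero, Finset.mem_univ, if_true]
  by_cases h1 : i = l <;> by_cases h2 : j = k <;> simp [h1, h2, eq_comm]

theorem mk_frame_entry (q₀ : ℂˣ) (k l : Fin n) (U : Matrix (Fin n) (Fin n) (RepRing n L)) :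
    Ideal.Quotient.mk (repIdeal n L q₀) (((1 / 2 : ℂ) • (U * momentZero (coord n L)
        + momentZero (coord n L) * U) : Matrix (Fin n) (Fin n) (RepRing n L)) k l) =
      algebraMap ℂ _ (q₀ : ℂ) * Ideal.Quotient.mk (repIdeal n L q₀) (U k l) := by
  rw [← Matrix.map_apply (f := Ideal.Quotient.mk (repIdeal n L q₀)), map_mk_smul]
  simp only [Matrix.map_add _ (map_add _), Matrix.map_mul,
    map_mk_momentZero, Matrix.mul_smul, Matrix.smul_mul, Matrix.mul_one, Matrix.one_mul]
  rw [show ∀ a : Matrix (Fin n) (Fin n) (RepRing n L ⧸ repIdeal n L q₀),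
    (1 / 2 : ℂ) • ((q₀ : ℂ) • a + (q₀ : ℂ) • a) = (q₀ : ℂ) • a from fun a => by module]
  rw [Matrix.smul_apply, Matrix.map_apply, Algebra.smul_def]

theorem mk_frame_entry' (q₀ : ℂˣ) (U : Matrix Unit Unit (RepRing n L)) :
    Ideal.Quotient.mk (repIdeal n L q₀) ((-((1 / 2 : ℂ) • (momentInf (coord n L) * U
        + U * momentInf (coord n L))) : Matrix Unit Unit (RepRing n L)) () ()) =
      algebraMap ℂ _ (-((q₀⁻¹ ^ n : ℂˣ) : ℂ)) *
        Ideal.Quotient.mk (repIdeal n L q₀) (U () ()) := by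
  have h : -((1 / 2 : ℂ) • (momentInf (coord n L) * U + U * momentInf (coord n L)))
      = (-(1 / 2) : ℂ) • (momentInf (coord n L) * U + U * momentInf (coord n L)) := by
    rw [neg_smul]
  rw [h, ← Matrix.map_apply (f := Ideal.Quotient.mk (repIdeal n L q₀)), map_mk_smul]
  simp only [Matrix.map_add _ (map_add _), Matrix.map_mul,
    map_mk_momentInf, Matrix.mul_smul, Matrix.smul_mul, Matrix.mul_one, Matrix.one_mul]
  rw [show ∀ (z : ℂ) (a : Matrix Unit Unit (RepRing n L ⧸ repIdeal n L q₀)),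
    (-(1 / 2) : ℂ) • (z • a + z • a) = (-z) • a from fun z a => by module]
  rw [Matrix.smul_apply, Matrix.map_apply, Algebra.smul_def]

theorem bracket_coord_momentZero (c : Coord n) (k l : Fin n) :
    repBracket (coord n L c) (momentZero (coord n L) k l) =
      ((momentZero (coord n L)).map (hamiltonianField (coord n L c))) k l := by
  rw [Matrix.map_apply, hamiltonianField_apply]

theorem bracket_coord_momentInf (c : Coord n) :
    repBracket (coord n L c) (momentInf (coord n L) () ()) =
      ((momentInf (coord n L)).map (hamiltonianField (coord n L c))) () () := by
  rw [Matrix.map_apply, hamiltonianField_apply]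

theorem mk_bracket_momentZero (q₀ : ℂˣ) (f : RepRing n L) (k l : Fin n) :
    Ideal.Quotient.mk (repIdeal n L q₀) (repBracket f (momentZero (coord n L) k l)) =
      algebraMap ℂ _ (q₀ : ℂ) * Ideal.Quotient.mk (repIdeal n L q₀)
        (actionField n L (Matrix.single l k 1) f) := by
  have key : reduceD (repIdeal n L q₀) (-hamiltonianField (momentZero (coord n L) k l)) =
      (q₀ : ℂ) • reduceD (repIdeal n L q₀) (actionField n L (Matrix.single l k 1)) := by
    apply derivation_ext
    intro c
    rw [Derivation.smul_apply, reduceD_apply, reduceD_apply, Derivation.neg_apply,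
      hamiltonianField_apply, ← repBracket_swap, bracket_coord_momentZero, actionField,
      vectorField_coord, Algebra.smul_def]
    cases c with
    | X i j =>
      rw [momentZero_X i j _ rfl]
      exact mk_loop_entry q₀ i j k l 𝐗
    | Y i j =>
      rw [momentZero_Y i j _ rfl]
      exact mk_loop_entry q₀ i j k l 𝐘
    | V i =>
      rw [momentZero_V i _ rfl, mk_frame_entry]
      congr 2
      simp [point, Matrix.mul_apply, Matrix.single_apply, ite_and, eq_comm]
    | W j =>
      rw [momentZero_W j _ rfl, mk_frame_entry]
      congr 2
      simp [point, Matrix.mul_apply, Matrix.single_apply, ite_and, eq_comm]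
  have := DFunLike.congr_fun key f
  rwa [Derivation.smul_apply, reduceD_apply, reduceD_apply, Derivation.neg_apply,
      hamiltonianField_apply, ← repBracket_swap, Algebra.smul_def] at this

theorem mk_bracket_momentInf (q₀ : ℂˣ) (f : RepRing n L) :
    Ideal.Quotient.mk (repIdeal n L q₀) (repBracket f (momentInf (coord n L) () ())) =
      algebraMap ℂ _ (-((q₀⁻¹ ^ n : ℂˣ) : ℂ)) * Ideal.Quotient.mk (repIdeal n L q₀)
        (actionField n L 1 f) := by
  have key : reduceD (repIdeal n L q₀) (-hamiltonianField (momentInf (coord n L) () ())) =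
      (-((q₀⁻¹ ^ n : ℂˣ) : ℂ)) • reduceD (repIdeal n L q₀) (actionField n L 1) := by
    apply derivation_ext
    intro c
    rw [Derivation.smul_apply, reduceD_apply, reduceD_apply, Derivation.neg_apply,
      hamiltonianField_apply, ← repBracket_swap, bracket_coord_momentInf, actionField,
      vectorField_coord, Algebra.smul_def]
    cases c with
    | X i j =>
      rw [momentInf_X i j]
      simp [point]
    | Y i j =>
      rw [momentInf_Y i j]
      simp [point]
    | V i =>
      rw [momentInf_V i _ rfl, mk_frame_entry']
      congr 2
      simp [point, Matrix.mul_apply, Matrix.single_apply, matV, Matrix.one_apply]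
    | W j =>
      rw [momentInf_W j _ rfl, mk_frame_entry']
      congr 2
      simp [point, Matrix.mul_apply, Matrix.single_apply, matW]
  have := DFunLike.congr_fun key f
  rwa [Derivation.smul_apply, reduceD_apply, reduceD_apply, Derivation.neg_apply,
      hamiltonianField_apply, ← repBracket_swap, Algebra.smul_def] at this

end Moment

section Action

/-- The point `(G X G', G Y G', G V, W G')`; for `G' = G⁻¹` this is the action of `G` on the point
`(X, Y, V, W)`. -/
def conjPoint {S : Type*} [CommRing S] (G G' : Matrix (Fin n) (Fin n) S) (p : Coord n → S) :
    Coord n → S :=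
  point (G * matX p * G') (G * matY p * G') (G * matV p) (matW p * G')

theorem denAt_conjPoint {S : Type*} [CommRing S] (G G' : Matrix (Fin n) (Fin n) S)
    (h : G * G' = 1) (p : Coord n → S) : denAt L (conjPoint G G' p) = denAt L p := by
  have h' : G' * G = 1 := mul_eq_one_comm.mp h
  have hdet : ∀ M : Matrix (Fin n) (Fin n) S, (G * M * G').det = M.det := fun M => by
    rw [Matrix.det_mul, Matrix.det_mul, mul_right_comm, ← Matrix.det_mul, h, Matrix.det_one,
      one_mul]
  have hX : matX (conjPoint G G' p) = G * matX p * G' := rfl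
  have hY : matY (conjPoint G G' p) = G * matY p * G' := rfl
  have hV : matV (conjPoint G G' p) = G * matV p := rfl
  have hW : matW (conjPoint G G' p) = matW p * G' := rfl
  have e : ∀ {k : Type} (M : Matrix (Fin n) k S), G' * (G * M) = M := fun M => by
    rw [← Matrix.mul_assoc, h', Matrix.one_mul]
  have h1 : ∀ M : Matrix (Fin n) (Fin n) S, 1 + G * M * G' = G * (1 + M) * G' := fun M => by
    rw [Matrix.mul_add, Matrix.add_mul, Matrix.mul_one, h]
  have e1 : 1 + G * matX p * G' * (G * matY p * G') = G * (1 + matX p * matY p) * G' := by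
    rw [← h1]; simp only [Matrix.mul_assoc, e]
  have e2 : 1 + G * matY p * G' * (G * matX p * G') = G * (1 + matY p * matX p) * G' := by
    rw [← h1]; simp only [Matrix.mul_assoc, e]
  have e3 : 1 + G * matV p * (matW p * G') = G * (1 + matV p * matW p) * G' := by
    rw [← h1]; simp only [Matrix.mul_assoc]
  have e4 : 1 + matW p * G' * (G * matV p) = 1 + matW p * matV p := by
    simp only [Matrix.mul_assoc, e]
  unfold denAt
  rw [hX, hY, hV, hW, e1, e2, e3, e4, hdet, hdet, hdet]
  cases L
  · rfl
  · simp only [hdet]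

theorem isUnit_conjPoint {S : Type*} [CommRing S] (G G' : Matrix (Fin n) (Fin n) S)
    (h : G * G' = 1) (f : RepRing n L →+* S) :
    IsUnit (denAt L (conjPoint G G' fun c => f (coord n L c))) := by
  rw [denAt_conjPoint G G' h, ← map_denAt]
  exact isUnit_denAt.map f

/-- The homomorphism `f ↦ f(G · -)` for an `S`-valued matrix `G` with inverse `G'`. -/
noncomputable def conjHom {S : Type*} [CommRing S] [Algebra ℂ S] [Algebra (RepRing n L) S]
    (G G' : Matrix (Fin n) (Fin n) S) (h : G * G' = 1) : RepRing n L →ₐ[ℂ] S :=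
  evalAt (conjPoint G G' fun c => algebraMap (RepRing n L) S (coord n L c))
    (isUnit_conjPoint G G' h _)

theorem conjHom_coord {S : Type*} [CommRing S] [Algebra ℂ S] [Algebra (RepRing n L) S]
    (G G' : Matrix (Fin n) (Fin n) S) (h : G * G' = 1) (c : Coord n) :
    conjHom G G' h (coord n L c) =
      conjPoint G G' (fun c => algebraMap (RepRing n L) S (coord n L c)) c := by
  simp [conjHom]

theorem map_conjPoint {S T : Type*} [CommRing S] [CommRing T] (f : S →+* T)
    (G G' : Matrix (Fin n) (Fin n) S) (p : Coord n → S) (c : Coord n) :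
    f (conjPoint G G' p c) = conjPoint (G.map f) (G'.map f) (fun c => f (p c)) c := by
  cases c <;> simp [conjPoint, point, ← matX_map, ← matY_map, ← matV_map, ← matW_map,
    ← Matrix.map_mul]

theorem comp_conjHom {S T : Type*} [CommRing S] [Algebra ℂ S] [Algebra (RepRing n L) S]
    [CommRing T] [Algebra ℂ T] [Algebra (RepRing n L) T]
    (φ : S →ₐ[ℂ] T) (hφ : ∀ r : RepRing n L, φ (algebraMap _ S r) = algebraMap _ T r)
    (G G' : Matrix (Fin n) (Fin n) S) (h : G * G' = 1) (h2 : G.map φ * G'.map φ = 1)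
    (f : RepRing n L) :
    φ (conjHom G G' h f) = conjHom (G.map φ) (G'.map φ) h2 f := by
  have : φ.comp (conjHom (L := L) G G' h) = conjHom (G.map φ) (G'.map φ) h2 := by
    apply algHom_ext
    intro c
    rw [AlgHom.comp_apply, conjHom_coord, conjHom_coord]
    have := map_conjPoint (φ : S →+* T) G G' (fun c => algebraMap (RepRing n L) S (coord n L c)) c
    simpa [hφ] using this
  exact DFunLike.congr_fun this f

variable (L) in
/-- The action of `g ∈ GL_n(ℂ)` on functions, `f ↦ f(g · -)` where
`g · (X, Y, V, W) = (g X g⁻¹, g Y g⁻¹, g V, W g⁻¹)`. -/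
noncomputable def glAction (g : GL (Fin n) ℂ) : RepRing n L →ₐ[ℂ] RepRing n L :=
  conjHom ((g : Matrix (Fin n) (Fin n) ℂ).map (algebraMap ℂ (RepRing n L)))
    ((↑g⁻¹ : Matrix (Fin n) (Fin n) ℂ).map (algebraMap ℂ (RepRing n L))) (by
      rw [← Matrix.map_mul, ← Units.val_mul, mul_inv_cancel]
      simp)

end Action

section Infinitesimal

open LaurentPolynomial DualNumber

/-- The unit `1 + ε` of the dual numbers. -/
noncomputable def onePlusEps (R : Type*) [CommRing R] : R[ε]ˣ where
  val := 1 + ε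
  inv := 1 - ε
  val_inv := by ring_nf; simp [DualNumber.eps_pow_two]
  inv_val := by ring_nf; simp [DualNumber.eps_pow_two]

theorem fst_onePlusEps_zpow {R : Type*} [CommRing R] (k : ℤ) :
    ((onePlusEps R ^ k : R[ε]ˣ) : R[ε]) = 1 + (k : R) • ε := by
  induction k with
  | zero => simp
  | succ k ih =>
    rw [_root_.zpow_add_one, Units.val_mul, ih]
    ext <;> simp [onePlusEps, add_comm]
  | pred k ih =>
    rw [_root_.zpow_sub_one, Units.val_mul, ih]
    ext <;> simp [onePlusEps]; ring

/-- Evaluation of Laurent polynomials at a unit. -/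
noncomputable def laurentEval {R S : Type*} [CommRing R] [Algebra ℂ R] [CommRing S] [Algebra ℂ S]
    [Algebra R S] [IsScalarTower ℂ R S] (x : Sˣ) : R[T;T⁻¹] →ₐ[ℂ] S :=
  { LaurentPolynomial.eval₂ (algebraMap R S) x with
    commutes' := fun r => by
      simp [LaurentPolynomial.algebraMap_apply, ← IsScalarTower.algebraMap_apply] }

theorem laurentEval_C_mul_T {R S : Type*} [CommRing R] [Algebra ℂ R] [CommRing S] [Algebra ℂ S]
    [Algebra R S] [IsScalarTower ℂ R S] (x : Sˣ) (a : R) (k : ℤ) :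
    laurentEval x (C a * T k) = algebraMap R S a * ((x ^ k : Sˣ) : S) :=
  LaurentPolynomial.eval₂_C_mul_T _ _ _ _

theorem laurentEval_eq_sum {R S : Type*} [CommRing R] [Algebra ℂ R] [CommRing S] [Algebra ℂ S]
    [Algebra R S] [IsScalarTower ℂ R S] (x : Sˣ) (p : R[T;T⁻¹]) :
    laurentEval x p = p.coeff.sum fun k a => algebraMap R S a * ((x ^ k : Sˣ) : S) := by
  induction p using LaurentPolynomial.induction_on' with
  | add p q hp hq =>
    rw [map_add, hp, hq]
    exact (Finsupp.sum_add_index' (fun k => by rw [map_zero, zero_mul])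
      (fun k a b => by rw [map_add, add_mul])).symm
  | C_mul_T k a =>
    rw [laurentEval_C_mul_T, ← LaurentPolynomial.single_eq_C_mul_T]
    exact (Finsupp.sum_single_index (h := fun (k : ℤ) (a : R) =>
      algebraMap R S a * ((x ^ k : Sˣ) : S)) (by simp)).symm

theorem laurent_coeff_mem {R : Type*} [CommRing R] [Algebra ℂ R] (I : Ideal R) (m : R)
    (p : R[T;T⁻¹])
    (h : ∀ c : ℂˣ, laurentEval (Units.map (algebraMap ℂ R : ℂ →* R) c) p - m ∈ I) (k : ℤ)
    (hk : k ≠ 0) : p.coeff k ∈ I := by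
  classical
  rw [← Ideal.Quotient.eq_zero_iff_mem, ← Module.forall_dual_apply_eq_zero_iff ℂ]
  intro φ
  let ψ : R →ₗ[ℂ] ℂ := φ ∘ₗ (Ideal.Quotient.mkₐ ℂ I).toLinearMap
  change ψ (p.coeff k) = 0
  have hψ : ∀ r ∈ I, ψ r = 0 := fun r hr => by
    change φ (Ideal.Quotient.mk I r) = 0
    rw [Ideal.Quotient.eq_zero_iff_mem.mpr hr, map_zero]
  let χ : ℤ → (ℂˣ →* ℂ) := fun k => (Units.coeHom ℂ).comp (zpowGroupHom k)
  have hχ : Function.Injective χ := by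
    intro a b hab
    have := DFunLike.congr_fun hab (Units.mk0 2 two_ne_zero)
    have h3 : (2 : ℂ) ^ a = (2 : ℂ) ^ b := by simpa [χ] using this
    have h4 : (2 : ℝ) ^ a = (2 : ℝ) ^ b := by
      have := congrArg norm h3
      simpa using this
    exact zpow_right_injective₀ (by norm_num) (by norm_num) h4
  have hli : LinearIndependent ℂ (fun k : ℤ => (χ k : ℂˣ → ℂ)) :=
    (linearIndependent_monoidHom ℂˣ ℂ).comp χ hχ
  rw [linearIndependent_iff] at hli
  let g : ℤ →₀ ℂ := p.coeff.mapRange ψ (map_zero _) - Finsupp.single 0 (ψ m)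
  have hg := hli g (by
    ext c
    have h1 := hψ _ (h c)
    rw [map_sub, laurentEval_eq_sum, sub_eq_zero, Finsupp.sum, map_sum] at h1
    rw [map_sub, Finsupp.linearCombination_single, Finsupp.linearCombination_apply,
      Finsupp.sum_mapRange_index (by simp), Pi.sub_apply, Finsupp.sum, Finset.sum_apply,
      Pi.zero_apply, sub_eq_zero]
    refine Eq.trans (Finset.sum_congr rfl fun j _ => ?_) (h1.trans ?_)
    · have : ((Units.map (algebraMap ℂ R : ℂ →* R) c ^ j : Rˣ) : R)
          = algebraMap ℂ R ((c ^ j : ℂˣ) : ℂ) := by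
        rw [← map_zpow]; rfl
      rw [this, Algebra.algebraMap_self, RingHom.id_apply, mul_comm, ← Algebra.smul_def, map_smul,
        Pi.smul_apply, smul_eq_mul, smul_eq_mul, mul_comm]
      rfl
    · simp [χ])
  have := DFunLike.congr_fun hg k
  simpa [g, hk.symm, Finsupp.single_apply] using this

theorem laurent_derivative_mem {R : Type*} [CommRing R] [Algebra ℂ R] (I : Ideal R) (m : R)
    (p : R[T;T⁻¹])
    (h : ∀ c : ℂˣ, laurentEval (Units.map (algebraMap ℂ R : ℂ →* R) c) p - m ∈ I) :
    (laurentEval (onePlusEps R) p).snd ∈ I := by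
  rw [laurentEval_eq_sum, Finsupp.sum]
  have : ∀ (s : Finset ℤ) (u : ℤ → R[ε]), (∑ k ∈ s, u k).snd = ∑ k ∈ s, (u k).snd := by
    intro s u
    exact map_sum (TrivSqZeroExt.sndHom R R) u s
  rw [this]
  refine Ideal.sum_mem _ fun k _ => ?_
  rw [fst_onePlusEps_zpow]
  by_cases hk : k = 0
  · subst hk; simp [TrivSqZeroExt.algebraMap_eq_inl]
  · have := laurent_coeff_mem I m p h k hk
    simp only [TrivSqZeroExt.algebraMap_eq_inl]
    simpa using Ideal.mul_mem_right _ I this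

theorem one_add_smul_mul {S : Type*} [CommRing S] {E : Matrix (Fin n) (Fin n) S} {e s s' : S}
    (hE : E * E = e • E) (h : s + s' + s * s' * e = 0) :
    (1 + s • E) * (1 + s' • E) = 1 := by
  have : (1 + s • E) * (1 + s' • E) = 1 + (s + s' + s * s' * e) • E := by
    simp only [Matrix.add_mul, Matrix.mul_add, Matrix.one_mul, Matrix.mul_one, Matrix.smul_mul,
      Matrix.mul_smul, hE]
    module
  rw [this, h, zero_smul, add_zero]

theorem conj_dual {S : Type*} [CommRing S] {s : S} (hs : s * s = 0)
    (E M : Matrix (Fin n) (Fin n) S) :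
    (1 + s • E) * M * (1 + (-s) • E) = M + s • (E * M - M * E) := by
  have h0 : ∀ N : Matrix (Fin n) (Fin n) S, s • s • N = 0 := fun N => by
    rw [smul_smul, hs, zero_smul]
  simp only [Matrix.add_mul, Matrix.mul_add, Matrix.one_mul, Matrix.mul_one, Matrix.smul_mul,
    Matrix.mul_smul, neg_smul, h0, smul_neg, smul_sub]
  abel_nf
  try simp [h0]

theorem conjHom_congr {S : Type*} [CommRing S] [Algebra ℂ S] [Algebra (RepRing n L) S]
    {G G' H H' : Matrix (Fin n) (Fin n) S} (h : G * G' = 1) (h2 : H * H' = 1)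
    (e : G = H) (e' : G' = H') : conjHom (L := L) G G' h = conjHom H H' h2 := by
  subst e e'; rfl

theorem conjHom_dual (E : Matrix (Fin n) (Fin n) (RepRing n L))
    (h : (1 + (ε : (RepRing n L)[ε]) • E.map (algebraMap _ (RepRing n L)[ε])) *
      (1 + (-ε : (RepRing n L)[ε]) • E.map (algebraMap _ (RepRing n L)[ε])) = 1)
    (f : RepRing n L) :
    (conjHom _ _ h f).snd = actionField n L E f := by
  have : conjHom _ _ h = dualHom (L := L) (point (E * matX (coord n L) - matX (coord n L) * E)
      (E * matY (coord n L) - matY (coord n L) * E) (E * matV (coord n L))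
      (-(matW (coord n L) * E))) := by
    apply algHom_ext
    intro c
    rw [conjHom_coord, dualHom, evalAt_coord]
    have hε : (ε : (RepRing n L)[ε]) * ε = 0 := DualNumber.eps_mul_eps
    have hi : ∀ a b : RepRing n L, (TrivSqZeroExt.inl a + TrivSqZeroExt.inr b : (RepRing n L)[ε])
        = algebraMap _ _ a + ε * algebraMap _ _ b := fun a b => by
      ext <;> simp [TrivSqZeroExt.algebraMap_eq_inl]
    rw [hi]
    have hm : ∀ {a b d : Type} [Fintype b] (M : Matrix a b (RepRing n L))
        (N : Matrix b d (RepRing n L)),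
        M.map (algebraMap _ (RepRing n L)[ε]) * N.map (algebraMap _ (RepRing n L)[ε]) =
          (M * N).map (algebraMap _ (RepRing n L)[ε]) := fun M N => Matrix.map_mul.symm
    cases c with
    | X i j =>
      simp only [conjPoint, point, ← matX_map, conj_dual hε, hm]
      simp [matX, -Matrix.map_mul]
    | Y i j =>
      simp only [conjPoint, point, ← matY_map, conj_dual hε, hm]
      simp [matY, -Matrix.map_mul]
    | V i =>
      simp only [conjPoint, point, ← matV_map, Matrix.add_mul, Matrix.smul_mul, hm]
      simp [matV, -Matrix.map_mul]
    | W j =>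
      simp only [conjPoint, point, ← matW_map, Matrix.mul_add, Matrix.mul_smul, hm]
      simp [matW, -Matrix.map_mul]
  rw [this]
  rfl

theorem actionField_mem (I : Ideal (RepRing n L)) (f : RepRing n L)
    (hf : ∀ g : GL (Fin n) ℂ, glAction L g f - f ∈ I) (E : Matrix (Fin n) (Fin n) ℂ) (e : ℂ)
    (hE : E * E = e • E) (he : e = 0 ∨ e = 1) :
    actionField n L (E.map (algebraMap ℂ _)) f ∈ I := by
  have hEmap : ∀ (S : Type) [CommRing S] [Algebra ℂ S],
      E.map (algebraMap ℂ S) * E.map (algebraMap ℂ S)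
        = algebraMap ℂ S e • E.map (algebraMap ℂ S) := by
    intro S _ _
    rw [← Matrix.map_mul, hE]
    ext i j
    simp
  let S := (RepRing n L)[T;T⁻¹]
  obtain ⟨s', hs', hc, hε⟩ : ∃ s' : S, (T 1 - 1 : S) + s' + (T 1 - 1) * s' * algebraMap ℂ S e = 0 ∧
      (∀ c : ℂˣ, ∃ z : ℂ, ((c : ℂ) - 1) + z + (c - 1) * z * e = 0 ∧
        laurentEval (Units.map (algebraMap ℂ (RepRing n L) : ℂ →* _) c) s'
          = algebraMap ℂ (RepRing n L) z) ∧
      laurentEval (onePlusEps (RepRing n L)) s' = -ε := by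
    have hTk : ∀ (A : Type) [CommRing A] [Algebra ℂ A] [Algebra (RepRing n L) A]
        [IsScalarTower ℂ (RepRing n L) A] (x : Aˣ) (k : ℤ),
        laurentEval (R := RepRing n L) x (T k) = (x ^ k : Aˣ) := by
      intro A _ _ _ _ x k
      have := laurentEval_C_mul_T (R := RepRing n L) x 1 k
      simpa using this
    rcases he with rfl | rfl
    · refine ⟨1 - T 1, by simp, fun c => ⟨1 - c, by ring, ?_⟩, ?_⟩
      · rw [map_sub, map_one, hTk]; simp
      · rw [map_sub, map_one, hTk]; simp [onePlusEps]
    · refine ⟨T (-1) - 1, ?_, fun c => ⟨(c : ℂ)⁻¹ - 1, ?_, ?_⟩, ?_⟩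
      · have : (T 1 * T (-1) : (RepRing n L)[T;T⁻¹]) = 1 := by rw [← T_add]; simp
        rw [map_one]
        linear_combination this
      · have := mul_inv_cancel₀ c.ne_zero
        linear_combination this
      · rw [map_sub, map_one, hTk, map_sub, map_one, _root_.zpow_neg_one, ← map_inv]
        simp
      · rw [map_sub, map_one, hTk]; simp [onePlusEps]
  have hE' := hEmap S
  have hGG' := one_add_smul_mul hE' hs'
  have hT : ∀ (A : Type) [CommRing A] [Algebra ℂ A] [Algebra (RepRing n L) A]
      [IsScalarTower ℂ (RepRing n L) A] (x : Aˣ) (t : S),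
      (1 + t • E.map (algebraMap ℂ S)).map (laurentEval (R := RepRing n L) x) =
        1 + laurentEval x t • E.map (algebraMap ℂ A) := by
    intro A _ _ _ _ x t
    ext i j
    have hcm : laurentEval (R := RepRing n L) x (algebraMap ℂ S (E i j)) = algebraMap ℂ A (E i j) :=
      (laurentEval (R := RepRing n L) x).commutes (E i j)
    by_cases hij : i = j
    · subst hij; simp [hcm]
    · simp [hij, hcm]
  have hT1 : ∀ (A : Type) [CommRing A] [Algebra ℂ A] [Algebra (RepRing n L) A]
      [IsScalarTower ℂ (RepRing n L) A] (x : Aˣ),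
      laurentEval (R := RepRing n L) x (T 1 - 1) = x - 1 := by
    intro A _ _ _ _ x
    have := laurentEval_C_mul_T (R := RepRing n L) x 1 1
    rw [map_sub, map_one]
    simpa using this
  have halg : ∀ (A : Type) [CommRing A] [Algebra ℂ A] [Algebra (RepRing n L) A]
      [IsScalarTower ℂ (RepRing n L) A] (x : Aˣ) (r : RepRing n L),
      laurentEval (R := RepRing n L) x (algebraMap _ S r) = algebraMap _ A r := by
    intro A _ _ _ _ x r
    have := laurentEval_C_mul_T (R := RepRing n L) x r 0
    simp only [T_zero, mul_one, zpow_zero, Units.val_one] at this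
    exact this
  have key := laurent_derivative_mem I f (conjHom (L := L) _ _ hGG' f) ?_
  · have h1 : (1 + (T 1 - 1 : S) • E.map (algebraMap ℂ S)).map
        (laurentEval (R := RepRing n L) (onePlusEps (RepRing n L))) =
        1 + (ε : (RepRing n L)[ε]) • (E.map (algebraMap ℂ (RepRing n L))).map (algebraMap _ _) := by
      rw [hT, hT1]
      have : ((onePlusEps (RepRing n L) : (RepRing n L)[ε]) - 1) = ε := by simp [onePlusEps]
      rw [this]
      rfl
    have h2 : (1 + s' • E.map (algebraMap ℂ S)).map
        (laurentEval (R := RepRing n L) (onePlusEps (RepRing n L))) =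
        1 + (-ε : (RepRing n L)[ε]) • (E.map (algebraMap ℂ (RepRing n L))).map
          (algebraMap _ _) := by
      rw [hT, hε]
      rfl
    have h3 := congrArg (fun M => M.map (laurentEval (R := RepRing n L)
      (onePlusEps (RepRing n L)))) hGG'
    simp only [Matrix.map_mul] at h3
    rw [Matrix.map_one _ (map_zero _) (map_one _)] at h3
    rw [comp_conjHom _ (halg _ _) _ _ hGG' h3, conjHom_congr h3 (by rw [← h1, ← h2]; exact h3) h1 h2,
      conjHom_dual] at key
    exact key
  · intro c
    obtain ⟨z, hz, hz'⟩ := hc c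
    have hg := one_add_smul_mul hE hz
    let g : GL (Fin n) ℂ := ⟨_, _, hg, mul_eq_one_comm.mp hg⟩
    have hsm : ∀ t : ℂ, (1 + t • E).map (algebraMap ℂ (RepRing n L)) =
        1 + algebraMap ℂ (RepRing n L) t • E.map (algebraMap ℂ (RepRing n L)) := by
      intro t
      ext i j
      by_cases hij : i = j
      · subst hij; simp; rw [← Algebra.smul_def]
      · simp [hij]; rw [← Algebra.smul_def]
    let x : (RepRing n L)ˣ := Units.map (algebraMap ℂ (RepRing n L) : ℂ →* _) c
    have h1 : (1 + (T 1 - 1 : S) • E.map (algebraMap ℂ S)).map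
        (laurentEval (R := RepRing n L) x) =
        (1 + ((c : ℂ) - 1) • E).map (algebraMap ℂ (RepRing n L)) := by
      rw [hT, hT1, hsm]
      simp [x]
    have h2 : (1 + s' • E.map (algebraMap ℂ S)).map (laurentEval (R := RepRing n L) x) =
        (1 + z • E).map (algebraMap ℂ (RepRing n L)) := by
      rw [hT, hz', hsm]
    have h3 := congrArg (fun M => M.map (laurentEval (R := RepRing n L) x)) hGG'
    simp only [Matrix.map_mul] at h3
    rw [Matrix.map_one _ (map_zero _) (map_one _)] at h3
    rw [comp_conjHom _ (halg _ _) _ _ hGG' h3, conjHom_congr h3 (by rw [← h1, ← h2]; exact h3) h1 h2]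
    exact hf g

end Infinitesimal

section Equivariance

/-- An arrow as a generator. -/
def Arrow.toGen : Arrow → Gen
  | .x => .x
  | .y => .y
  | .v => .v
  | .w => .w

theorem repBracket_zero_left (f : RepRing n L) : repBracket 0 f = 0 := by
  simp [repBracket]

theorem repBracket_zero_right (f : RepRing n L) : repBracket f 0 = 0 := by
  simp [repBracket]

set_option maxHeartbeats 4000000 in
theorem repBracket_block (a b : Arrow) (i j u v : Idx n) :
    repBracket (genMatrix (coord n L) a.toGen i j) (genMatrix (coord n L) b.toGen u v) =
      entryPairing (coord n L) i j u v (doubleBracket a b) := by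
  cases a <;> cases b <;>
  simp only [Arrow.toGen, doubleBracket, dblXY, dblVW, dblLoopV, dblLoopW, map_zero, map_neg,
    map_add, map_sub, map_smul, entryPairing_swap, entryPairing_tmul, rep_gen, map_mul, genMatrix,
    Matrix.fromBlocks_multiply, Matrix.mul_zero, Matrix.zero_mul, add_zero, zero_add] <;>
  rcases i with i | i <;> rcases j with j | j <;> rcases u with u | u <;> rcases v with v | v <;>
  simp only [Matrix.fromBlocks_apply₁₁, Matrix.fromBlocks_apply₁₂, Matrix.fromBlocks_apply₂₁,
    Matrix.fromBlocks_apply₂₂, Matrix.zero_apply, repBracket_zero_left, repBracket_zero_right,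
    mul_zero, zero_mul, add_zero, sub_zero, smul_zero, neg_zero] <;>
  simp [matX, matY, matV, matW, coordBracket, doubleBracket,
      dblXY, dblVW, dblLoopV, dblLoopW, Coord.row, Coord.col, genMatrix, entryPairing_swap,
      Coord.arrow, Matrix.fromBlocks_multiply]

variable (n L) in
/-- The bracket as a bilinear map. -/
noncomputable def repBracketL : RepRing n L →ₗ[ℂ] RepRing n L →ₗ[ℂ] RepRing n L :=
  LinearMap.mk₂ ℂ repBracket
    (fun f f' g => by rw [repBracket_swap, ← hamiltonianField_apply, map_add,
      hamiltonianField_apply, hamiltonianField_apply, neg_add, ← repBracket_swap,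
      ← repBracket_swap])
    (fun z f g => by rw [repBracket_swap, ← hamiltonianField_apply, Derivation.map_smul,
      hamiltonianField_apply, ← smul_neg, ← repBracket_swap])
    (fun f g g' => by simp only [← hamiltonianField_apply, map_add])
    (fun z f g => by simp only [← hamiltonianField_apply, Derivation.map_smul])

theorem repBracketL_apply (f g : RepRing n L) : repBracketL n L f g = repBracket f g := rfl

/-- The block matrix `diag(g, 1)`. -/
def blockOf (g : Matrix (Fin n) (Fin n) ℂ) : Matrix (Idx n) (Idx n) ℂ :=
  Matrix.fromBlocks g 0 0 1

theorem map_blockOf (g : Matrix (Fin n) (Fin n) ℂ) :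
    (blockOf g).map (algebraMap ℂ (RepRing n L)) =
      Matrix.fromBlocks (g.map (algebraMap ℂ (RepRing n L))) 0 0 1 := by
  rw [blockOf, Matrix.fromBlocks_map]
  simp

theorem blockOf_mul_inv (g : GL (Fin n) ℂ) :
    (blockOf (g : Matrix (Fin n) (Fin n) ℂ)).map (algebraMap ℂ (RepRing n L)) *
      (blockOf (↑g⁻¹ : Matrix (Fin n) (Fin n) ℂ)).map (algebraMap ℂ (RepRing n L)) = 1 ∧
    (blockOf (↑g⁻¹ : Matrix (Fin n) (Fin n) ℂ)).map (algebraMap ℂ (RepRing n L)) *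
      (blockOf (g : Matrix (Fin n) (Fin n) ℂ)).map (algebraMap ℂ (RepRing n L)) = 1 := by
  constructor <;>
  · rw [← Matrix.map_mul, blockOf, blockOf, Matrix.fromBlocks_multiply]
    simp [← Units.val_mul, -Matrix.coe_units_inv]

theorem glAction_coord (g : GL (Fin n) ℂ) (c : Coord n) :
    glAction L g (coord n L c) =
      conjPoint ((g : Matrix (Fin n) (Fin n) ℂ).map (algebraMap ℂ (RepRing n L)))
        ((↑g⁻¹ : Matrix (Fin n) (Fin n) ℂ).map (algebraMap ℂ (RepRing n L))) (coord n L) c := by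
  rw [glAction, conjHom_coord]
  rfl

theorem map_glAction_genMatrix (g : GL (Fin n) ℂ) (a : Gen) :
    (genMatrix (coord n L) a).map (glAction L g) =
      (blockOf (g : Matrix (Fin n) (Fin n) ℂ)).map (algebraMap ℂ (RepRing n L)) *
        genMatrix (coord n L) a *
      (blockOf (↑g⁻¹ : Matrix (Fin n) (Fin n) ℂ)).map (algebraMap ℂ (RepRing n L)) := by
  have h1 : (1 : Matrix (Fin n) (Fin n) (RepRing n L)).map (glAction L g) = 1 :=
    Matrix.map_one _ (map_zero _) (map_one _)
  have h1' : (1 : Matrix Unit Unit (RepRing n L)).map (glAction L g) = 1 :=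
    Matrix.map_one _ (map_zero _) (map_one _)
  have h2 : (g : Matrix (Fin n) (Fin n) ℂ).map (algebraMap ℂ (RepRing n L)) *
      (↑g⁻¹ : Matrix (Fin n) (Fin n) ℂ).map (algebraMap ℂ (RepRing n L)) = 1 := by
    rw [← Matrix.map_mul, ← Units.val_mul, mul_inv_cancel]
    simp
  have h0 : ∀ a b : Type, (0 : Matrix a b (RepRing n L)).map (glAction L g) = 0 :=
    fun a b => Matrix.map_zero _ (map_zero _)
  rw [map_blockOf, map_blockOf]
  cases a <;>
  simp only [genMatrix, Matrix.fromBlocks_map, Matrix.fromBlocks_multiply, Matrix.mul_zero,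
    Matrix.zero_mul, add_zero, zero_add, Matrix.mul_one, Matrix.one_mul, h0, h1, h1', h2,
    matX_map, matY_map, matV_map, matW_map, glAction_coord] <;> rfl

theorem map_glAction_rep (g : GL (Fin n) ℂ) (p : PathAlg) :
    (rep (coord n L) p).map (glAction L g) =
      (blockOf (g : Matrix (Fin n) (Fin n) ℂ)).map (algebraMap ℂ (RepRing n L)) *
        rep (coord n L) p *
      (blockOf (↑g⁻¹ : Matrix (Fin n) (Fin n) ℂ)).map (algebraMap ℂ (RepRing n L)) := by
  obtain ⟨hG, hG'⟩ := blockOf_mul_inv (L := L) g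
  obtain ⟨f, rfl⟩ : ∃ f, RingQuot.mkAlgHom ℂ PathRel f = p :=
    RingQuot.mkAlgHom_surjective ℂ PathRel p
  induction f using FreeAlgebra.induction with
  | grade0 z =>
    have : rep (coord n L) (RingQuot.mkAlgHom ℂ PathRel (algebraMap ℂ _ z))
        = algebraMap ℂ _ z := by
      rw [AlgHom.commutes]
      exact (rep (coord n L)).commutes z
    rw [this, Algebra.algebraMap_eq_smul_one, Matrix.mul_smul, Matrix.smul_mul, Matrix.mul_one, hG]
    ext i j
    by_cases hij : i = j
    · subst hij; simp
    · simp [hij]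
  | grade1 a =>
    have := rep_gen (coord n L) a
    rw [gen] at this
    rw [this]
    exact map_glAction_genMatrix g a
  | mul a b ha hb =>
    have : rep (coord n L) (RingQuot.mkAlgHom ℂ PathRel (a * b)) =
        rep (coord n L) (RingQuot.mkAlgHom ℂ PathRel a) *
        rep (coord n L) (RingQuot.mkAlgHom ℂ PathRel b) := by
      rw [map_mul]
      exact map_mul (rep (coord n L)) _ _
    rw [this, Matrix.map_mul, ha, hb]
    simp only [Matrix.mul_assoc]
    rw [← Matrix.mul_assoc (Matrix.map (blockOf (↑g⁻¹ : Matrix (Fin n) (Fin n) ℂ)) _)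
      (Matrix.map _ _), hG', Matrix.one_mul]
  | add a b ha hb =>
    have : rep (coord n L) (RingQuot.mkAlgHom ℂ PathRel (a + b)) =
        rep (coord n L) (RingQuot.mkAlgHom ℂ PathRel a) +
        rep (coord n L) (RingQuot.mkAlgHom ℂ PathRel b) := by
      rw [map_add]
      exact map_add (rep (coord n L)) _ _
    rw [this, Matrix.map_add _ (map_add _), ha, hb, Matrix.mul_add, Matrix.add_mul]

theorem conj_entry {S : Type*} [CommRing S] [Algebra ℂ S] (h h' : Matrix (Idx n) (Idx n) ℂ)
    (M : Matrix (Idx n) (Idx n) S) (i j : Idx n) :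
    (h.map (algebraMap ℂ S) * M * h'.map (algebraMap ℂ S)) i j =
      ∑ p, ∑ q, (h i p * h' q j) • M p q := by
  simp only [Matrix.mul_apply, Matrix.map_apply, Finset.sum_mul, Algebra.smul_def, map_mul]
  rw [Finset.sum_comm]
  exact Finset.sum_congr rfl fun p _ => Finset.sum_congr rfl fun q _ => by ring

theorem sum_reorder {ι M : Type*} [Fintype ι] [AddCommMonoid M] (F : ι → ι → ι → M) :
    ∑ r, ∑ q, ∑ p, F r q p = ∑ p, ∑ q, ∑ r, F r q p := by
  calc ∑ r, ∑ q, ∑ p, F r q p = ∑ r, ∑ p, ∑ q, F r q p :=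
        Finset.sum_congr rfl fun r _ => Finset.sum_comm
    _ = ∑ p, ∑ r, ∑ q, F r q p := Finset.sum_comm
    _ = _ := Finset.sum_congr rfl fun p _ => Finset.sum_comm

theorem sum_rotate {ι M : Type*} [Fintype ι] [AddCommMonoid M] (F : ι → ι → ι → M) :
    ∑ a, ∑ b, ∑ c, F a b c = ∑ b, ∑ c, ∑ a, F a b c := by
  rw [Finset.sum_comm]
  exact Finset.sum_congr rfl fun b _ => Finset.sum_comm

theorem sum_rotate₂ {ι M : Type*} [Fintype ι] [AddCommMonoid M] (F : ι → ι → ι → ι → M) :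
    ∑ a, ∑ b, ∑ c, ∑ d, F a b c d = ∑ c, ∑ d, ∑ a, ∑ b, F a b c d := by
  rw [← sum_rotate (fun a c d => ∑ b, F a b c d)]
  exact Finset.sum_congr rfl fun a _ => sum_rotate (F a)

theorem glAction_entryPairing (g : GL (Fin n) ℂ) (i j u v : Idx n)
    (t : PathAlg ⊗[ℂ] PathAlg) :
    glAction L g (entryPairing (coord n L) i j u v t) =
      ∑ p, ∑ q, (blockOf (g : Matrix (Fin n) (Fin n) ℂ) i p *
          blockOf (↑g⁻¹ : Matrix (Fin n) (Fin n) ℂ) q j) •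
        ∑ r, ∑ s, (blockOf (g : Matrix (Fin n) (Fin n) ℂ) u r *
          blockOf (↑g⁻¹ : Matrix (Fin n) (Fin n) ℂ) s v) •
          entryPairing (coord n L) p q r s t := by
  induction t using TensorProduct.induction_on with
  | zero => simp
  | tmul a b =>
    simp only [entryPairing_tmul, map_mul]
    rw [← Matrix.map_apply (f := glAction L g), ← Matrix.map_apply (f := glAction L g),
      map_glAction_rep, map_glAction_rep, conj_entry, conj_entry]
    simp only [Finset.sum_mul, Finset.smul_sum]
    rw [← sum_reorder (fun r q p => ∑ s, _)]
    refine Finset.sum_congr rfl fun r _ => Finset.sum_congr rfl fun q _ => ?_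
    rw [Finset.mul_sum]
    refine Finset.sum_congr rfl fun p _ => ?_
    rw [Finset.mul_sum]
    refine Finset.sum_congr rfl fun s _ => ?_
    simp only [Algebra.smul_def, map_mul]
    ring
  | add a b ha hb => simp only [map_add, ha, hb, smul_add, Finset.sum_add_distrib]

theorem glAction_block (g : GL (Fin n) ℂ) (a : Gen) (i j : Idx n) :
    glAction L g (genMatrix (coord n L) a i j) =
      ∑ p, ∑ q, (blockOf (g : Matrix (Fin n) (Fin n) ℂ) i p *
          blockOf (↑g⁻¹ : Matrix (Fin n) (Fin n) ℂ) q j) • genMatrix (coord n L) a p q := by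
  rw [← Matrix.map_apply (f := glAction L g), map_glAction_genMatrix, conj_entry]

theorem repBracket_glAction_block (g : GL (Fin n) ℂ) (a b : Arrow) (i j u v : Idx n) :
    repBracket (glAction L g (genMatrix (coord n L) a.toGen i j))
        (glAction L g (genMatrix (coord n L) b.toGen u v)) =
      glAction L g (repBracket (genMatrix (coord n L) a.toGen i j)
        (genMatrix (coord n L) b.toGen u v)) := by
  rw [repBracket_block, glAction_entryPairing, glAction_block, glAction_block,
    ← repBracketL_apply]
  simp only [map_sum, map_smul, LinearMap.sum_apply, LinearMap.smul_apply, repBracketL_apply,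
    repBracket_block, Finset.smul_sum]
  rw [sum_rotate₂]
  refine Finset.sum_congr rfl fun p _ => Finset.sum_congr rfl fun q _ =>
    Finset.sum_congr rfl fun r _ => Finset.sum_congr rfl fun s _ => ?_
  rw [smul_comm]

theorem coord_eq_block (c : Coord n) :
    coord n L c = genMatrix (coord n L) c.arrow.toGen c.row c.col := by
  cases c <;> rfl

theorem glAction_inv_apply (g : GL (Fin n) ℂ) (f : RepRing n L) :
    glAction L g⁻¹ (glAction L g f) = f := by
  have : (glAction L g⁻¹).comp (glAction L g) = AlgHom.id ℂ _ := by
    apply algHom_ext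
    intro c
    rw [AlgHom.comp_apply, coord_eq_block]
    have h : ((genMatrix (coord n L) c.arrow.toGen).map (glAction L g)).map (glAction L g⁻¹) =
        genMatrix (coord n L) c.arrow.toGen := by
      obtain ⟨hG, hG'⟩ := blockOf_mul_inv (L := L) g
      have hc : ∀ M : Matrix (Idx n) (Idx n) ℂ,
          (M.map (algebraMap ℂ (RepRing n L))).map (glAction L g⁻¹) =
            M.map (algebraMap ℂ (RepRing n L)) := fun M => by
        ext i j
        exact (glAction L g⁻¹).commutes (M i j)
      rw [map_glAction_genMatrix, Matrix.map_mul, Matrix.map_mul, map_glAction_genMatrix, hc, hc,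
        inv_inv]
      simp only [← Matrix.mul_assoc, hG, Matrix.one_mul]
      rw [Matrix.mul_assoc, hG, Matrix.mul_one]
    exact congrFun (congrFun h c.row) c.col
  exact DFunLike.congr_fun this f

theorem repBracket_glAction (g : GL (Fin n) ℂ) (f h : RepRing n L) :
    repBracket (glAction L g f) (glAction L g h) = glAction L g (repBracket f h) := by
  -- the derivation `h ↦ g⁻¹ {g f, g h}`
  let D : RepRing n L → Derivation ℂ (RepRing n L) (RepRing n L) := fun f =>
    Derivation.mk' ((glAction L g⁻¹).toLinearMap ∘ₗ
      (hamiltonianField (glAction L g f)).toLinearMap ∘ₗ (glAction L g).toLinearMap) (by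
        intro a b
        simp [glAction_inv_apply])
  have hD : ∀ f h, D f h = glAction L g⁻¹ (repBracket (glAction L g f) (glAction L g h)) :=
    fun f h => by rw [← hamiltonianField_apply]; rfl
  have hswap : ∀ f h, D f h = -D h f := fun f h => by
    rw [hD, hD, repBracket_swap, map_neg]
  have h1 : ∀ c d : Coord n, D (coord n L c) (coord n L d) =
      hamiltonianField (coord n L c) (coord n L d) := fun c d => by
    rw [hD, hamiltonianField_apply, coord_eq_block c, coord_eq_block d,
      repBracket_glAction_block, glAction_inv_apply]
  have h2 : ∀ c : Coord n, D (coord n L c) = hamiltonianField (coord n L c) :=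
    fun c => derivation_ext (h1 c)
  have h3 : ∀ f, D f = hamiltonianField f := fun f => derivation_ext fun c => by
    rw [hswap, h2, hamiltonianField_apply, hamiltonianField_apply, ← repBracket_swap]
  have h4 := DFunLike.congr_fun (h3 f) h
  rw [hD, hamiltonianField_apply] at h4
  have h5 := congrArg (glAction L g) h4
  have h6 := glAction_inv_apply (L := L) g⁻¹ (repBracket (glAction L g f) (glAction L g h))
  rw [inv_inv] at h6
  rw [← h5, h6]

end Equivariance

section Reduction

theorem map_nonsing_inv {m : Type*} [Fintype m] [DecidableEq m] {R S : Type*} [CommRing R]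
    [CommRing S] (φ : R →+* S) (M : Matrix m m R) (h : IsUnit M.det) :
    M⁻¹.map φ = (M.map φ)⁻¹ := by
  refine (Matrix.inv_eq_right_inv ?_).symm
  rw [← Matrix.map_mul, Matrix.mul_nonsing_inv _ h, Matrix.map_one _ (map_zero φ) (map_one φ)]

theorem map_one_add_mul {l m : Type*} [Fintype m] [DecidableEq l] {R S : Type*}
    [CommRing R] [CommRing S] (φ : R →+* S) (M : Matrix l m R) (N : Matrix m l R) :
    (1 + M * N).map φ = 1 + M.map φ * N.map φ := by
  rw [Matrix.map_add _ (map_add φ), Matrix.map_mul, Matrix.map_one _ (map_zero φ) (map_one φ)]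

theorem momentZero_map {R S : Type*} [CommRing R] [CommRing S] (φ : R →+* S) (p : Coord n → R)
    (h : IsUnit (1 + matY p * matX p).det) :
    (momentZero p).map φ = momentZero fun c => φ (p c) := by
  rw [momentZero, Matrix.map_mul, Matrix.map_mul, map_nonsing_inv _ _ h, map_one_add_mul,
    map_one_add_mul, map_one_add_mul]
  rfl

theorem momentInf_map {R S : Type*} [CommRing R] [CommRing S] (φ : R →+* S) (p : Coord n → R)
    (h : IsUnit (1 + matW p * matV p).det) :
    (momentInf p).map φ = momentInf fun c => φ (p c) := by
  rw [momentInf, map_nonsing_inv _ _ h, map_one_add_mul]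
  rfl

theorem conj_inv {S : Type*} [CommRing S] {G G' : Matrix (Fin n) (Fin n) S} (h : G * G' = 1)
    (M : Matrix (Fin n) (Fin n) S) : (G * M * G')⁻¹ = G * M⁻¹ * G' := by
  rw [Matrix.mul_inv_rev, Matrix.mul_inv_rev, Matrix.inv_eq_right_inv h,
    Matrix.inv_eq_left_inv h, Matrix.mul_assoc]

theorem conj_mul {S : Type*} [CommRing S] {G G' : Matrix (Fin n) (Fin n) S} (h : G * G' = 1)
    (M N : Matrix (Fin n) (Fin n) S) : (G * M * G') * (G * N * G') = G * (M * N) * G' := by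
  have h' : G' * G = 1 := mul_eq_one_comm.mp h
  simp only [Matrix.mul_assoc]
  rw [← Matrix.mul_assoc G' G, h', Matrix.one_mul]

theorem one_add_conj {S : Type*} [CommRing S] {G G' : Matrix (Fin n) (Fin n) S} (h : G * G' = 1)
    (M : Matrix (Fin n) (Fin n) S) : 1 + G * M * G' = G * (1 + M) * G' := by
  rw [Matrix.mul_add, Matrix.add_mul, Matrix.mul_one, h]

theorem momentZero_conjPoint {S : Type*} [CommRing S] {G G' : Matrix (Fin n) (Fin n) S}
    (h : G * G' = 1) (p : Coord n → S) :
    momentZero (conjPoint G G' p) = G * momentZero p * G' := by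
  have hX : matX (conjPoint G G' p) = G * matX p * G' := rfl
  have hY : matY (conjPoint G G' p) = G * matY p * G' := rfl
  have hV : matV (conjPoint G G' p) = G * matV p := rfl
  have hW : matW (conjPoint G G' p) = matW p * G' := rfl
  have e : G * matV p * (matW p * G') = G * (matV p * matW p) * G' := by
    simp only [Matrix.mul_assoc]
  rw [momentZero, hX, hY, hV, hW, e, conj_mul h, conj_mul h, one_add_conj h, one_add_conj h,
    one_add_conj h, conj_inv h, conj_mul h, conj_mul h, momentZero]

theorem momentInf_conjPoint {S : Type*} [CommRing S] {G G' : Matrix (Fin n) (Fin n) S}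
    (h : G * G' = 1) (p : Coord n → S) :
    momentInf (conjPoint G G' p) = momentInf p := by
  have h' : G' * G = 1 := mul_eq_one_comm.mp h
  have hV : matV (conjPoint G G' p) = G * matV p := rfl
  have hW : matW (conjPoint G G' p) = matW p * G' := rfl
  rw [momentInf, hV, hW, Matrix.mul_assoc, ← Matrix.mul_assoc G' G, h', Matrix.one_mul, momentInf]

theorem mul_inv_map {S : Type*} [CommRing S] [Algebra ℂ S] (g : GL (Fin n) ℂ) :
    (g : Matrix (Fin n) (Fin n) ℂ).map (algebraMap ℂ S) *
      (↑g⁻¹ : Matrix (Fin n) (Fin n) ℂ).map (algebraMap ℂ S) = 1 := by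
  rw [← Matrix.map_mul, ← Units.val_mul, mul_inv_cancel]
  simp

theorem glAction_coord_fun (g : GL (Fin n) ℂ) :
    (fun c => glAction L g (coord n L c)) =
      conjPoint ((g : Matrix (Fin n) (Fin n) ℂ).map (algebraMap ℂ (RepRing n L)))
        ((↑g⁻¹ : Matrix (Fin n) (Fin n) ℂ).map (algebraMap ℂ (RepRing n L))) (coord n L) :=
  funext (glAction_coord g)

theorem glAction_momentZero (g : GL (Fin n) ℂ) :
    (momentZero (coord n L)).map (glAction L g) =
      (g : Matrix (Fin n) (Fin n) ℂ).map (algebraMap ℂ (RepRing n L)) * momentZero (coord n L) *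
        (↑g⁻¹ : Matrix (Fin n) (Fin n) ℂ).map (algebraMap ℂ (RepRing n L)) := by
  have h := momentZero_map (glAction L g : RepRing n L →+* RepRing n L) (coord n L)
    isUnit_factors.2.1
  have h2 := glAction_coord_fun (L := L) g
  simp only [AlgHom.coe_toRingHom] at h
  rw [h, h2, momentZero_conjPoint (mul_inv_map g)]

theorem glAction_momentInf (g : GL (Fin n) ℂ) :
    (momentInf (coord n L)).map (glAction L g) = momentInf (coord n L) := by
  have h := momentInf_map (glAction L g : RepRing n L →+* RepRing n L) (coord n L)
    isUnit_factors.2.2.2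
  have h2 := glAction_coord_fun (L := L) g
  simp only [AlgHom.coe_toRingHom] at h
  rw [h, h2, momentInf_conjPoint (mul_inv_map g)]

/-- The action of `GL_n` preserves the ideal of `Rep(Λ^q, (1, n))`. -/
theorem repIdeal_le_comap (q₀ : ℂˣ) (g : GL (Fin n) ℂ) :
    repIdeal n L q₀ ≤ (repIdeal n L q₀).comap (glAction L g) := by
  refine Ideal.span_le.mpr ?_
  rintro f (⟨i, j, rfl⟩ | ⟨i, j, rfl⟩)
  · have h : ((momentZero (coord n L) - (q₀ : ℂ) • 1).map (glAction L g)) =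
        (g : Matrix (Fin n) (Fin n) ℂ).map (algebraMap ℂ (RepRing n L)) *
          (momentZero (coord n L) - (q₀ : ℂ) • 1) *
        (↑g⁻¹ : Matrix (Fin n) (Fin n) ℂ).map (algebraMap ℂ (RepRing n L)) := by
      rw [Matrix.map_sub _ (map_sub _), glAction_momentZero, Matrix.mul_sub, Matrix.sub_mul,
        Matrix.mul_smul, Matrix.smul_mul, Matrix.mul_one, mul_inv_map,
        Matrix.map_smul _ _ (map_smul _ _), Matrix.map_one _ (map_zero _) (map_one _)]
    have h2 := congrFun (congrFun h i) j
    rw [Matrix.map_apply] at h2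
    change glAction L g _ ∈ repIdeal n L q₀
    rw [h2, Matrix.mul_apply]
    refine Ideal.sum_mem _ fun l _ => Ideal.mul_mem_right _ _ ?_
    rw [Matrix.mul_apply]
    exact Ideal.sum_mem _ fun k _ => Ideal.mul_mem_left _ _
      (Ideal.subset_span (Or.inl ⟨k, l, rfl⟩))
  · have h : ((momentInf (coord n L) - ((q₀⁻¹ ^ n : ℂˣ) : ℂ) • 1).map (glAction L g)) =
        momentInf (coord n L) - ((q₀⁻¹ ^ n : ℂˣ) : ℂ) • 1 := by
      rw [Matrix.map_sub _ (map_sub _), glAction_momentInf,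
        Matrix.map_smul _ _ (map_smul _ _), Matrix.map_one _ (map_zero _) (map_one _)]
    have h2 := congrFun (congrFun h i) j
    rw [Matrix.map_apply] at h2
    change glAction L g _ ∈ repIdeal n L q₀
    rw [h2]
    exact Ideal.subset_span (Or.inr ⟨i, j, rfl⟩)

/-- The action of `GL_n` on `𝒪(Rep(Λ^q, (1, n)))`. -/
noncomputable def quotAction (q₀ : ℂˣ) (g : GL (Fin n) ℂ) :
    (RepRing n L ⧸ repIdeal n L q₀) →ₐ[ℂ] (RepRing n L ⧸ repIdeal n L q₀) :=
  Ideal.quotientMapₐ (repIdeal n L q₀) (glAction L g) (repIdeal_le_comap q₀ g)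

theorem quotAction_mk (q₀ : ℂˣ) (g : GL (Fin n) ℂ) (f : RepRing n L) :
    quotAction q₀ g (Ideal.Quotient.mk (repIdeal n L q₀) f) =
      Ideal.Quotient.mk (repIdeal n L q₀) (glAction L g f) := rfl

variable (n L) in
/-- The coordinate ring `𝒪(Rep(Λ^q, (1, n)))^{GL_n}` of `C_{n,q₀} = Rep(Λ^q, (1, n)) // GL_n`
(respectively of its open subset `C°_{n,q₀}` on which `X` is invertible). -/
noncomputable def CMRing (q₀ : ℂˣ) : Subalgebra ℂ (RepRing n L ⧸ repIdeal n L q₀) where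
  carrier := {f | ∀ g : GL (Fin n) ℂ, quotAction q₀ g f = f}
  mul_mem' ha hb g := by rw [map_mul, ha g, hb g]
  add_mem' ha hb g := by rw [map_add, ha g, hb g]
  algebraMap_mem' r g := (quotAction q₀ g).commutes r

theorem glAction_sub_mem {q₀ : ℂˣ} {f : RepRing n L}
    (hf : Ideal.Quotient.mk (repIdeal n L q₀) f ∈ CMRing n L q₀) (g : GL (Fin n) ℂ) :
    glAction L g f - f ∈ repIdeal n L q₀ := by
  rw [← Ideal.Quotient.eq, ← quotAction_mk]
  exact hf g

theorem repBracket_algebraMap (f : RepRing n L) (z : ℂ) :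
    repBracket f (algebraMap ℂ _ z) = 0 := by
  rw [← hamiltonianField_apply, Derivation.map_algebraMap]

theorem actionField_single_mem {I : Ideal (RepRing n L)} {f : RepRing n L}
    (hf : ∀ g : GL (Fin n) ℂ, glAction L g f - f ∈ I) (l k : Fin n) :
    actionField n L (Matrix.single l k 1) f ∈ I := by
  have h1 : (Matrix.single l k (1 : ℂ)).map (algebraMap ℂ (RepRing n L)) =
      Matrix.single l k 1 := by
    rw [Matrix.map_single, map_one]
  rw [← h1]
  by_cases hkl : k = l
  · subst hkl
    refine actionField_mem I f hf _ 1 ?_ (Or.inr rfl)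
    rw [Matrix.single_mul_single_same, mul_one, one_smul]
  · refine actionField_mem I f hf _ 0 ?_ (Or.inl rfl)
    rw [Matrix.single_mul_single_of_ne (h := hkl), zero_smul]

theorem actionField_one_mem {I : Ideal (RepRing n L)} {f : RepRing n L}
    (hf : ∀ g : GL (Fin n) ℂ, glAction L g f - f ∈ I) : actionField n L 1 f ∈ I := by
  have h1 : (1 : Matrix (Fin n) (Fin n) ℂ).map (algebraMap ℂ (RepRing n L)) = 1 :=
    Matrix.map_one _ (map_zero _) (map_one _)
  rw [← h1]
  exact actionField_mem I f hf _ 1 (by rw [Matrix.one_mul, one_smul]) (Or.inr rfl)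

/-- A function whose class modulo the ideal is invariant has brackets with the ideal inside the
ideal. -/
theorem repBracket_mem {q₀ : ℂˣ} {f h : RepRing n L}
    (hf : Ideal.Quotient.mk (repIdeal n L q₀) f ∈ CMRing n L q₀) (hh : h ∈ repIdeal n L q₀) :
    repBracket f h ∈ repIdeal n L q₀ := by
  have hf' := glAction_sub_mem hf
  induction hh using Submodule.span_induction with
  | zero => rw [repBracket_zero_right]; exact Ideal.zero_mem _
  | add a b _ _ ha hb =>
    have h1 : repBracket f (a + b) = repBracket f a + repBracket f b :=
      map_add (repBracketL n L f) a b
    rw [h1]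
    exact Ideal.add_mem _ ha hb
  | smul a b hb ih =>
    have h1 : repBracket f (a • b) = a * repBracket f b + b * repBracket f a := by
      rw [← hamiltonianField_apply, ← hamiltonianField_apply, ← hamiltonianField_apply,
        smul_eq_mul, Derivation.leibniz, smul_eq_mul, smul_eq_mul]
    rw [h1]
    exact Ideal.add_mem _ (Ideal.mul_mem_left _ _ ih) (Ideal.mul_mem_right _ _ hb)
  | mem x hx =>
    have hc : ∀ {k : Type} [DecidableEq k] (z : ℂ) (M : Matrix k k (RepRing n L)) (i j : k),
        repBracket f ((M - z • 1) i j) = repBracket f (M i j) := by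
      intro k _ z M i j
      have : (M - z • 1) i j = M i j - algebraMap ℂ _ (if i = j then z else 0) := by
        rw [Matrix.sub_apply, Matrix.smul_apply, Matrix.one_apply]
        split_ifs <;> simp [Algebra.algebraMap_eq_smul_one]
      rw [this, ← hamiltonianField_apply, map_sub, Derivation.map_algebraMap, sub_zero,
        hamiltonianField_apply]
    rcases hx with ⟨k, l, rfl⟩ | ⟨⟨⟩, ⟨⟩, rfl⟩
    · rw [hc, ← Ideal.Quotient.eq_zero_iff_mem, mk_bracket_momentZero]
      rw [Ideal.Quotient.eq_zero_iff_mem.mpr (actionField_single_mem hf' l k), mul_zero]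
    · rw [hc, ← Ideal.Quotient.eq_zero_iff_mem, mk_bracket_momentInf,
        Ideal.Quotient.eq_zero_iff_mem.mpr (actionField_one_mem hf'), mul_zero]

theorem mk_repBracket_congr {q₀ : ℂˣ} {f f' h h' : RepRing n L}
    (hf : Ideal.Quotient.mk (repIdeal n L q₀) f ∈ CMRing n L q₀)
    (hh : Ideal.Quotient.mk (repIdeal n L q₀) h ∈ CMRing n L q₀)
    (ef : Ideal.Quotient.mk (repIdeal n L q₀) f' = Ideal.Quotient.mk (repIdeal n L q₀) f)
    (eh : Ideal.Quotient.mk (repIdeal n L q₀) h' = Ideal.Quotient.mk (repIdeal n L q₀) h) :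
    Ideal.Quotient.mk (repIdeal n L q₀) (repBracket f' h') =
      Ideal.Quotient.mk (repIdeal n L q₀) (repBracket f h) := by
  have step : ∀ {a b b' : RepRing n L}, Ideal.Quotient.mk (repIdeal n L q₀) a ∈ CMRing n L q₀ →
      Ideal.Quotient.mk (repIdeal n L q₀) b' = Ideal.Quotient.mk (repIdeal n L q₀) b →
      Ideal.Quotient.mk (repIdeal n L q₀) (repBracket a b') =
        Ideal.Quotient.mk (repIdeal n L q₀) (repBracket a b) := by
    intro a b b' ha e
    rw [Ideal.Quotient.eq] at e ⊢
    have := repBracket_mem ha e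
    rwa [← hamiltonianField_apply, map_sub, hamiltonianField_apply, hamiltonianField_apply] at this
  rw [step (by rwa [ef]) eh, repBracket_swap, map_neg, step hh ef, ← map_neg, ← repBracket_swap]

/-- The Poisson bracket on the coordinate ring of `C_{n,q₀}` (or `C°_{n,q₀}`) induced by the double
bracket: lift two invariant functions arbitrarily from `Rep(Λ^q, (1, n))` to `Rep(A, (1, n))`, take
their bracket and restrict it to `Rep(Λ^q, (1, n))`. -/
noncomputable def poissonBracket {q₀ : ℂˣ} (f h : CMRing n L q₀) : CMRing n L q₀ :=
  ⟨Ideal.Quotient.mk (repIdeal n L q₀) (repBracket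
      (Quotient.out (f : RepRing n L ⧸ repIdeal n L q₀))
      (Quotient.out (h : RepRing n L ⧸ repIdeal n L q₀))), by
    intro g
    have hl : ∀ a : CMRing n L q₀, Ideal.Quotient.mk (repIdeal n L q₀)
        (Quotient.out (a : RepRing n L ⧸ repIdeal n L q₀)) = a :=
      fun a => Ideal.Quotient.mk_out _
    have hg : ∀ a : CMRing n L q₀, Ideal.Quotient.mk (repIdeal n L q₀)
        (glAction L g (Quotient.out (a : RepRing n L ⧸ repIdeal n L q₀))) = a :=
      fun a => by rw [← quotAction_mk, hl]; exact a.2 g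
    rw [quotAction_mk, ← repBracket_glAction]
    exact mk_repBracket_congr (by rw [hl]; exact f.2) (by rw [hl]; exact h.2)
      ((hg f).trans (hl f).symm) ((hg h).trans (hl h).symm)⟩

/-- The Poisson bracket does not depend on the lifts. -/
theorem poissonBracket_mk {q₀ : ℂˣ} (f h : CMRing n L q₀) (F H : RepRing n L)
    (hF : Ideal.Quotient.mk (repIdeal n L q₀) F = f)
    (hH : Ideal.Quotient.mk (repIdeal n L q₀) H = h) :
    (poissonBracket f h : RepRing n L ⧸ repIdeal n L q₀) =
      Ideal.Quotient.mk (repIdeal n L q₀) (repBracket F H) :=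
  mk_repBracket_congr (by rw [hF]; exact f.2) (by rw [hH]; exact h.2)
    ((Ideal.Quotient.mk_out _).trans hF.symm) ((Ideal.Quotient.mk_out _).trans hH.symm)

end Reduction

section Traces

variable (n L) in
/-- The restrictions of the coordinates to `Rep(Λ^q, (1, n))`. -/
noncomputable def cmCoord (q₀ : ℂˣ) (c : Coord n) : RepRing n L ⧸ repIdeal n L q₀ :=
  Ideal.Quotient.mk (repIdeal n L q₀) (coord n L c)

variable {q₀ : ℂˣ}

/-- A matrix-valued function on `Rep(Λ^q, (1, n))` which is equivariant for the conjugation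
action. -/
def IsEquivariant (M : Matrix (Fin n) (Fin n) (RepRing n L ⧸ repIdeal n L q₀)) : Prop :=
  ∀ g : GL (Fin n) ℂ, M.map (quotAction q₀ g) =
    (g : Matrix (Fin n) (Fin n) ℂ).map (algebraMap ℂ _) * M *
      (↑g⁻¹ : Matrix (Fin n) (Fin n) ℂ).map (algebraMap ℂ _)

theorem IsEquivariant.mul {M N : Matrix (Fin n) (Fin n) (RepRing n L ⧸ repIdeal n L q₀)}
    (hM : IsEquivariant M) (hN : IsEquivariant N) : IsEquivariant (M * N) := fun g => by
  rw [Matrix.map_mul, hM g, hN g, conj_mul (mul_inv_map g)]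

theorem IsEquivariant.one :
    IsEquivariant (1 : Matrix (Fin n) (Fin n) (RepRing n L ⧸ repIdeal n L q₀)) := fun g => by
  rw [Matrix.mul_one, mul_inv_map, Matrix.map_one _ (map_zero _) (map_one _)]

theorem IsEquivariant.add {M N : Matrix (Fin n) (Fin n) (RepRing n L ⧸ repIdeal n L q₀)}
    (hM : IsEquivariant M) (hN : IsEquivariant N) : IsEquivariant (M + N) := fun g => by
  rw [Matrix.map_add _ (map_add _), hM g, hN g, Matrix.mul_add, Matrix.add_mul]

theorem IsEquivariant.pow {M : Matrix (Fin n) (Fin n) (RepRing n L ⧸ repIdeal n L q₀)}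
    (hM : IsEquivariant M) (j : ℕ) : IsEquivariant (M ^ j) := by
  induction j with
  | zero => rw [_root_.pow_zero]; exact .one
  | succ j ih => rw [_root_.pow_succ]; exact ih.mul hM

theorem IsEquivariant.inv {M : Matrix (Fin n) (Fin n) (RepRing n L ⧸ repIdeal n L q₀)}
    (hM : IsEquivariant M) (hu : IsUnit M.det) : IsEquivariant M⁻¹ := fun g => by
  have := map_nonsing_inv (quotAction (L := L) q₀ g).toRingHom M hu
  rw [← conj_inv (mul_inv_map g), ← hM g]
  exact this

theorem IsEquivariant.zpow {M : Matrix (Fin n) (Fin n) (RepRing n L ⧸ repIdeal n L q₀)}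
    (hM : IsEquivariant M) (hu : IsUnit M.det) (j : ℤ) : IsEquivariant (M ^ j) := by
  cases j with
  | ofNat j => rw [Int.ofNat_eq_natCast, _root_.zpow_natCast]; exact hM.pow j
  | negSucc j =>
    rw [_root_.zpow_negSucc]
    exact (hM.pow _).inv (by rw [Matrix.det_pow]; exact hu.pow _)

theorem equivariant_coord (g : GL (Fin n) ℂ) (c : Coord n) :
    quotAction q₀ g (cmCoord n L q₀ c) =
      conjPoint ((g : Matrix (Fin n) (Fin n) ℂ).map (algebraMap ℂ _))
        ((↑g⁻¹ : Matrix (Fin n) (Fin n) ℂ).map (algebraMap ℂ _)) (cmCoord n L q₀) c := by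
  rw [cmCoord, quotAction_mk, glAction_coord, map_conjPoint]
  rfl

theorem equivariant_X : IsEquivariant (matX (cmCoord n L q₀)) := fun g => by
  rw [matX_map]
  ext i j
  exact equivariant_coord g (.X i j)

theorem equivariant_Y : IsEquivariant (matY (cmCoord n L q₀)) := fun g => by
  rw [matY_map]
  ext i j
  exact equivariant_coord g (.Y i j)

theorem isUnit_one_add_XY :
    IsUnit (1 + matX (cmCoord n L q₀) * matY (cmCoord n L q₀)).det := by
  have h := (isUnit_factors (n := n) (L := L)).1.map (Ideal.Quotient.mk (repIdeal n L q₀))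
  rwa [RingHom.map_det, RingHom.mapMatrix_apply, map_one_add_mul] at h

theorem isUnit_X : IsUnit (matX (cmCoord n .invX q₀)).det := by
  have h := isUnit_denAt (n := n) (L := .invX)
  simp only [denAt, IsUnit.mul_iff] at h
  have h2 := h.2.map (Ideal.Quotient.mk (repIdeal n .invX q₀))
  rwa [RingHom.map_det, RingHom.mapMatrix_apply] at h2

theorem isUnit_Y_add_X_inv :
    IsUnit (matY (cmCoord n .invX q₀) + (matX (cmCoord n .invX q₀))⁻¹).det := by
  have h : 1 + matX (cmCoord n .invX q₀) * matY (cmCoord n .invX q₀) =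
      matX (cmCoord n .invX q₀) * (matY (cmCoord n .invX q₀) + (matX (cmCoord n .invX q₀))⁻¹) := by
    rw [Matrix.mul_add, Matrix.mul_nonsing_inv _ isUnit_X, add_comm]
  have h2 := isUnit_one_add_XY (n := n) (L := .invX) (q₀ := q₀)
  rw [h, Matrix.det_mul, IsUnit.mul_iff] at h2
  exact h2.2

/-- The trace of an equivariant matrix, as an element of the coordinate ring. -/
noncomputable def traceFun (M : Matrix (Fin n) (Fin n) (RepRing n L ⧸ repIdeal n L q₀))
    (hM : IsEquivariant M) : CMRing n L q₀ :=
  ⟨M.trace, fun g => by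
    have h : quotAction q₀ g M.trace = (M.map (quotAction q₀ g)).trace :=
      map_sum (quotAction q₀ g) _ _
    have h2 := mul_eq_one_comm.mp (mul_inv_map (S := RepRing n L ⧸ repIdeal n L q₀) g)
    rw [h, hM g, Matrix.trace_mul_comm, ← Matrix.mul_assoc, h2, Matrix.one_mul]⟩

variable (n q₀) in
/-- `tr X^j` on `C_{n,q₀}`. -/
noncomputable def trX (j : ℕ) : CMRing n .whole q₀ :=
  traceFun (matX (cmCoord n .whole q₀) ^ j) (equivariant_X.pow j)

variable (n q₀) in
/-- `tr Y^j` on `C_{n,q₀}`. -/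
noncomputable def trY (j : ℕ) : CMRing n .whole q₀ :=
  traceFun (matY (cmCoord n .whole q₀) ^ j) (equivariant_Y.pow j)

variable (n q₀) in
/-- `tr (1 + XY)^j` on `C_{n,q₀}`, for `j ∈ ℤ`. -/
noncomputable def trOneAddXY (j : ℤ) : CMRing n .whole q₀ :=
  traceFun ((1 + matX (cmCoord n .whole q₀) * matY (cmCoord n .whole q₀)) ^ j)
    ((IsEquivariant.one.add (equivariant_X.mul equivariant_Y)).zpow isUnit_one_add_XY j)

variable (n q₀) in
/-- `tr (Y + X⁻¹)^j` on the open subset `C°_{n,q₀}` on which `X` is invertible, for `j ∈ ℤ`. -/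
noncomputable def trYAddXInv (j : ℤ) : CMRing n .invX q₀ :=
  traceFun ((matY (cmCoord n .invX q₀) + (matX (cmCoord n .invX q₀))⁻¹) ^ j)
    ((equivariant_Y.add (equivariant_X.inv isUnit_X)).zpow isUnit_Y_add_X_inv j)

end Traces

end RepRing
end TadpoleCM

namespace TadpoleCM

open Matrix

variable {n : ℕ} {L : Locus}

local notation "𝐗" => matX (coord n L)
local notation "𝐘" => matY (coord n L)

/-- The vector field `∑ E_ji {M_ij, -}`, that is `{tr (E M), -}` with `E` treated as a constant. -/
noncomputable def traceField (M E : Matrix (Fin n) (Fin n) (RepRing n L)) :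
    Derivation ℂ (RepRing n L) (RepRing n L) :=
  ∑ i, ∑ j, E j i • hamiltonianField (M i j)

theorem traceField_apply_eq_sum (M E : Matrix (Fin n) (Fin n) (RepRing n L)) (g : RepRing n L) :
    traceField M E g = ∑ i, ∑ j, E j i * hamiltonianField (M i j) g := by
  simp only [traceField, derivation_sum_apply, Derivation.smul_apply, smul_eq_mul]

theorem traceField_apply (M E : Matrix (Fin n) (Fin n) (RepRing n L)) (g : RepRing n L) :
    traceField M E g = -(E * M.map (hamiltonianField g)).trace := by
  rw [traceField_apply_eq_sum, Finset.sum_comm]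
  simp only [Matrix.trace, Matrix.diag, Matrix.mul_apply, ← Finset.sum_neg_distrib,
    Matrix.map_apply, hamiltonianField_apply]
  refine Finset.sum_congr rfl fun i _ => Finset.sum_congr rfl fun j _ => ?_
  rw [repBracket_swap, mul_neg]

theorem traceField_add_right (M E F : Matrix (Fin n) (Fin n) (RepRing n L)) :
    traceField M (E + F) = traceField M E + traceField M F := by
  ext g
  rw [Derivation.add_apply, traceField_apply, traceField_apply, traceField_apply, Matrix.add_mul,
    Matrix.trace_add, neg_add]

theorem traceField_single (M : Matrix (Fin n) (Fin n) (RepRing n L)) (i j : Fin n)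
    (r : RepRing n L) :
    traceField M (Matrix.single j i r) = r • hamiltonianField (M i j) := by
  ext g
  rw [traceField_apply_eq_sum, Finset.sum_eq_single i, Finset.sum_eq_single j]
  · simp
  · intro k _ hk
    simp [hk.symm]
  · simp
  · intro k _ hk
    simp [hk.symm]
  · simp

theorem traceField_add_left (M N E : Matrix (Fin n) (Fin n) (RepRing n L)) :
    traceField (M + N) E = traceField M E + traceField N E := by
  ext g
  simp only [Derivation.add_apply, traceField_apply, Matrix.map_add _ (map_add _), Matrix.mul_add,
    Matrix.trace_add, neg_add]

theorem traceField_one_add (M E : Matrix (Fin n) (Fin n) (RepRing n L)) :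
    traceField (1 + M) E = traceField M E := by
  ext g
  rw [traceField_apply, traceField_apply, map_one_add_derivation]

theorem traceField_one (E : Matrix (Fin n) (Fin n) (RepRing n L)) : traceField 1 E = 0 := by
  rw [← add_zero (1 : Matrix (Fin n) (Fin n) (RepRing n L)), traceField_one_add]
  ext g
  simp [traceField_apply]

theorem traceField_mul (M N E : Matrix (Fin n) (Fin n) (RepRing n L)) :
    traceField (M * N) E = traceField M (N * E) + traceField N (E * M) := by
  ext g
  rw [Derivation.add_apply, traceField_apply, traceField_apply, traceField_apply,
    map_mul_derivation, Matrix.mul_add, Matrix.trace_add, neg_add, Matrix.mul_assoc N,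
    Matrix.trace_mul_comm N]
  simp only [Matrix.mul_assoc]

theorem traceField_inv (M E : Matrix (Fin n) (Fin n) (RepRing n L)) (hM : IsUnit M.det) :
    traceField M⁻¹ E = traceField M (-(M⁻¹ * E * M⁻¹)) := by
  ext g
  rw [traceField_apply, traceField_apply, map_inv_derivation _ _ hM, Matrix.mul_neg,
    Matrix.neg_mul, Matrix.mul_assoc M⁻¹ E, Matrix.mul_assoc M⁻¹, Matrix.mul_assoc M⁻¹ (E * M⁻¹),
    Matrix.trace_neg, Matrix.trace_neg, Matrix.trace_mul_comm M⁻¹]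
  simp only [Matrix.mul_assoc]

theorem hamiltonianField_trace (M : Matrix (Fin n) (Fin n) (RepRing n L)) :
    hamiltonianField M.trace = traceField M 1 := by
  ext g
  rw [traceField_apply, Matrix.one_mul, hamiltonianField_apply, repBracket_swap,
    ← hamiltonianField_apply]
  exact congrArg Neg.neg (map_sum _ _ _)

/-- A formula for `traceField M` on a matrix of functions which is linear in the argument need only
be checked on the Hamiltonian vector fields of the entries. -/
theorem map_traceField_of_single {M N : Matrix (Fin n) (Fin n) (RepRing n L)}
    (Φ : Matrix (Fin n) (Fin n) (RepRing n L) → Matrix (Fin n) (Fin n) (RepRing n L))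
    (hadd : ∀ E F, Φ (E + F) = Φ E + Φ F) (hsmul : ∀ (r : RepRing n L) E, Φ (r • E) = r • Φ E)
    (h : ∀ i j, N.map (hamiltonianField (M i j)) = Φ (Matrix.single j i 1))
    (E : Matrix (Fin n) (Fin n) (RepRing n L)) : N.map (traceField M E) = Φ E := by
  induction E using Matrix.induction_on' with
  | h_zero =>
    have h0 := hsmul 0 0
    rw [zero_smul, zero_smul] at h0
    rw [h0]
    ext u v
    simp [traceField_apply]
  | h_add E F hE hF =>
    rw [hadd, ← hE, ← hF, traceField_add_right]
    rfl
  | h_std_basis j i r =>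
    have hr : Matrix.single j i r = r • Matrix.single j i (1 : RepRing n L) := by
      rw [Matrix.smul_single, smul_eq_mul, mul_one]
    rw [traceField_single, hr, hsmul, ← h]
    rfl

theorem map_X_traceField_X (E : Matrix (Fin n) (Fin n) (RepRing n L)) :
    (𝐗).map (traceField 𝐗 E) = (1 / 2 : ℂ) • (𝐗 * 𝐗 * E - E * (𝐗 * 𝐗)) := by
  refine map_traceField_of_single (fun E => (1 / 2 : ℂ) • (𝐗 * 𝐗 * E - E * (𝐗 * 𝐗))) ?_ ?_ ?_ E
  · intro E F
    simp only [Matrix.mul_add, Matrix.add_mul]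
    module
  · intro r E
    simp only [Matrix.mul_smul, Matrix.smul_mul, ← smul_sub]
    rw [smul_comm]
  · intro i j
    have h := (bracket_X (L := L) i j _ rfl).1
    simp only [Matrix.mul_one, Matrix.one_mul] at h
    exact h

theorem map_Y_traceField_X (E : Matrix (Fin n) (Fin n) (RepRing n L)) :
    (𝐘).map (traceField 𝐗 E) = E + (1 / 2 : ℂ) • (𝐘 * 𝐗 * E) + (1 / 2 : ℂ) • (E * (𝐗 * 𝐘))
      + (1 / 2 : ℂ) • (𝐘 * E * 𝐗 - 𝐗 * E * 𝐘) := by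
  refine map_traceField_of_single (fun E => E + (1 / 2 : ℂ) • (𝐘 * 𝐗 * E)
    + (1 / 2 : ℂ) • (E * (𝐗 * 𝐘)) + (1 / 2 : ℂ) • (𝐘 * E * 𝐗 - 𝐗 * E * 𝐘)) ?_ ?_ ?_ E
  · intro E F
    simp only [Matrix.mul_add, Matrix.add_mul]
    module
  · intro r E
    simp only [Matrix.mul_smul, Matrix.smul_mul, ← smul_sub, smul_add, smul_comm r (1 / 2 : ℂ)]
  · intro i j
    have h := (bracket_X (L := L) i j _ rfl).2.1
    simp only [Matrix.mul_one, Matrix.one_mul] at h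
    exact h

theorem map_X_traceField_Y (E : Matrix (Fin n) (Fin n) (RepRing n L)) :
    (𝐗).map (traceField 𝐘 E) = -(E + (1 / 2 : ℂ) • (E * (𝐘 * 𝐗)) + (1 / 2 : ℂ) • (𝐗 * 𝐘 * E)
      + (1 / 2 : ℂ) • (𝐗 * E * 𝐘 - 𝐘 * E * 𝐗)) := by
  refine map_traceField_of_single (fun E => -(E + (1 / 2 : ℂ) • (E * (𝐘 * 𝐗))
    + (1 / 2 : ℂ) • (𝐗 * 𝐘 * E) + (1 / 2 : ℂ) • (𝐗 * E * 𝐘 - 𝐘 * E * 𝐗))) ?_ ?_ ?_ E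
  · intro E F
    simp only [Matrix.mul_add, Matrix.add_mul]
    module
  · intro r E
    simp only [Matrix.mul_smul, Matrix.smul_mul, ← smul_sub, smul_add, smul_neg,
      smul_comm r (1 / 2 : ℂ)]
  · intro i j
    have h := (bracket_Y (L := L) i j _ rfl).1
    simp only [Matrix.mul_one, Matrix.one_mul] at h
    exact h

theorem map_Y_traceField_Y (E : Matrix (Fin n) (Fin n) (RepRing n L)) :
    (𝐘).map (traceField 𝐘 E) = (1 / 2 : ℂ) • (E * (𝐘 * 𝐘) - 𝐘 * 𝐘 * E) := by
  refine map_traceField_of_single (fun E => (1 / 2 : ℂ) • (E * (𝐘 * 𝐘) - 𝐘 * 𝐘 * E)) ?_ ?_ ?_ E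
  · intro E F
    simp only [Matrix.mul_add, Matrix.add_mul]
    module
  · intro r E
    simp only [Matrix.mul_smul, Matrix.smul_mul, ← smul_sub]
    rw [smul_comm]
  · intro i j
    have h := (bracket_Y (L := L) i j _ rfl).2.1
    simp only [Matrix.mul_one, Matrix.one_mul] at h
    exact h

/-- The bracket of the entries of `M` is `s (M² ⊗ 1 - 1 ⊗ M²)`. -/
def HasQuadraticBracket (M : Matrix (Fin n) (Fin n) (RepRing n L)) : Prop :=
  ∃ s : ℂ, ∀ E, M.map (traceField M E) = s • (M * M * E - E * (M * M))

theorem hasQuadraticBracket_X : HasQuadraticBracket 𝐗 := ⟨_, map_X_traceField_X⟩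

theorem hasQuadraticBracket_Y : HasQuadraticBracket 𝐘 :=
  ⟨-(1 / 2), fun E => by rw [map_Y_traceField_Y, neg_smul, ← smul_neg, neg_sub]⟩

theorem hasQuadraticBracket_one_add_XY : HasQuadraticBracket (1 + 𝐗 * 𝐘) := by
  refine ⟨1 / 2, fun E => ?_⟩
  have hX : (𝐗).map (traceField (𝐗 * 𝐘) E) =
      (𝐗).map (traceField 𝐗 (𝐘 * E)) + (𝐗).map (traceField 𝐘 (E * 𝐗)) := by
    rw [traceField_mul]; rfl
  have hY : (𝐘).map (traceField (𝐗 * 𝐘) E) =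
      (𝐘).map (traceField 𝐗 (𝐘 * E)) + (𝐘).map (traceField 𝐘 (E * 𝐗)) := by
    rw [traceField_mul]; rfl
  rw [traceField_one_add, map_one_add_derivation, map_mul_derivation, hX, hY, map_X_traceField_X,
    map_X_traceField_Y, map_Y_traceField_X, map_Y_traceField_Y]
  simp only [Matrix.mul_add, Matrix.add_mul, Matrix.mul_sub, Matrix.sub_mul, Matrix.smul_mul,
    Matrix.mul_smul, Matrix.mul_assoc, Matrix.one_mul, Matrix.mul_one, Matrix.neg_mul]
  module

theorem hasQuadraticBracket_Y_add_X_inv (hu : IsUnit (𝐗).det) :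
    HasQuadraticBracket (𝐘 + (𝐗)⁻¹) := by
  refine ⟨-(1 / 2), fun E => ?_⟩
  set Z := (𝐗)⁻¹ with hZ
  have h1 : 𝐗 * Z = 1 := Matrix.mul_nonsing_inv _ hu
  have h2 : Z * 𝐗 = 1 := Matrix.nonsing_inv_mul _ hu
  have h1' : ∀ M : Matrix (Fin n) (Fin n) (RepRing n L), 𝐗 * (Z * M) = M := fun M => by
    rw [← Matrix.mul_assoc, h1, Matrix.one_mul]
  have h2' : ∀ M : Matrix (Fin n) (Fin n) (RepRing n L), Z * (𝐗 * M) = M := fun M => by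
    rw [← Matrix.mul_assoc, h2, Matrix.one_mul]
  have hsplit : ∀ M : Matrix (Fin n) (Fin n) (RepRing n L), M.map (traceField (𝐘 + Z) E) =
      M.map (traceField 𝐘 E) + M.map (traceField 𝐗 (-(Z * E * Z))) := fun M => by
    rw [traceField_add_left, hZ, traceField_inv _ _ hu]; rfl
  rw [Matrix.map_add _ (map_add _), hZ, map_inv_derivation _ _ hu, ← hZ, hsplit, hsplit,
    map_X_traceField_X, map_X_traceField_Y, map_Y_traceField_X, map_Y_traceField_Y]
  simp only [Matrix.mul_add, Matrix.add_mul, Matrix.mul_sub, Matrix.sub_mul, Matrix.smul_mul,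
    Matrix.mul_smul, Matrix.mul_assoc, Matrix.mul_one, Matrix.mul_neg, Matrix.neg_mul, h1, h2, h1', h2']
  module

theorem exists_traceField_pow (M : Matrix (Fin n) (Fin n) (RepRing n L)) (k : ℕ) :
    ∀ E, Commute E M → ∃ P, Commute P M ∧ traceField (M ^ k) E = traceField M P := by
  induction k with
  | zero =>
    intro E _
    refine ⟨0, Commute.zero_left M, ?_⟩
    rw [_root_.pow_zero, traceField_one]
    ext g
    simp [traceField_apply]
  | succ k ih =>
    intro E hE
    obtain ⟨P, hP, h⟩ := ih (M * E) ((Commute.refl M).mul_left hE)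
    refine ⟨P + E * M ^ k, hP.add_left (hE.mul_left ((Commute.refl M).pow_left k)), ?_⟩
    rw [_root_.pow_succ, traceField_mul, h, traceField_add_right]

theorem exists_traceField_zpow (M : Matrix (Fin n) (Fin n) (RepRing n L)) (hM : IsUnit M.det)
    (k : ℤ) : ∃ P, Commute P M ∧ traceField (M ^ k) 1 = traceField M P := by
  cases k with
  | ofNat k =>
    rw [Int.ofNat_eq_natCast, _root_.zpow_natCast]
    exact exists_traceField_pow M k 1 (Commute.one_left M)
  | negSucc k =>
    have hu : IsUnit (M ^ (k + 1)).det := by rw [Matrix.det_pow]; exact hM.pow _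
    have hc : Commute (M ^ (k + 1))⁻¹ M := by
      have h := ((Commute.refl M).pow_left (k + 1)).eq
      calc (M ^ (k + 1))⁻¹ * M = (M ^ (k + 1))⁻¹ * (M * M ^ (k + 1)) * (M ^ (k + 1))⁻¹ := by
            rw [Matrix.mul_assoc, Matrix.mul_assoc, Matrix.mul_nonsing_inv _ hu, Matrix.mul_one]
        _ = M * (M ^ (k + 1))⁻¹ := by
            rw [← h, ← Matrix.mul_assoc, Matrix.nonsing_inv_mul _ hu, Matrix.one_mul]
    rw [_root_.zpow_negSucc, traceField_inv _ _ hu]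
    exact exists_traceField_pow M _ _ ((hc.mul_left (Commute.one_left M)).mul_left hc).neg_left

theorem map_pow_derivation_eq_zero {D : Derivation ℂ (RepRing n L) (RepRing n L)}
    {M : Matrix (Fin n) (Fin n) (RepRing n L)} (h : M.map D = 0) (k : ℕ) : (M ^ k).map D = 0 := by
  induction k with
  | zero =>
    rw [_root_.pow_zero, ← add_zero (1 : Matrix (Fin n) (Fin n) (RepRing n L)),
      map_one_add_derivation, Matrix.map_zero _ (map_zero _)]
  | succ k ih =>
    rw [_root_.pow_succ, map_mul_derivation, ih, h, Matrix.zero_mul, Matrix.mul_zero, add_zero]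

theorem map_zpow_derivation_eq_zero {D : Derivation ℂ (RepRing n L) (RepRing n L)}
    {M : Matrix (Fin n) (Fin n) (RepRing n L)} (hM : IsUnit M.det) (h : M.map D = 0) (k : ℤ) :
    (M ^ k).map D = 0 := by
  cases k with
  | ofNat k =>
    rw [Int.ofNat_eq_natCast, _root_.zpow_natCast]
    exact map_pow_derivation_eq_zero h k
  | negSucc k =>
    have hu : IsUnit (M ^ (k + 1)).det := by rw [Matrix.det_pow]; exact hM.pow _
    rw [_root_.zpow_negSucc, map_inv_derivation _ _ hu, map_pow_derivation_eq_zero h,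
      Matrix.mul_zero, Matrix.zero_mul, neg_zero]

theorem HasQuadraticBracket.repBracket_trace_eq_zero
    {M N N' : Matrix (Fin n) (Fin n) (RepRing n L)} (hM : HasQuadraticBracket M)
    (hN : ∃ P, Commute P M ∧ traceField N 1 = traceField M P)
    (hN' : ∀ D : Derivation ℂ (RepRing n L) (RepRing n L), M.map D = 0 → N'.map D = 0) :
    repBracket N.trace N'.trace = 0 := by
  obtain ⟨s, hs⟩ := hM
  obtain ⟨P, hP, h⟩ := hN
  have h0 : N'.map (traceField M P) = 0 := by
    apply hN'
    rw [hs, (hP.mul_right hP).eq, sub_self, smul_zero]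
  rw [← hamiltonianField_apply, hamiltonianField_trace, h]
  have h1 : traceField M P N'.trace = (N'.map (traceField M P)).trace := map_sum _ _ _
  rw [h1, h0, Matrix.trace_zero]

theorem HasQuadraticBracket.repBracket_trace_pow {M : Matrix (Fin n) (Fin n) (RepRing n L)}
    (hM : HasQuadraticBracket M) (j k : ℕ) : repBracket (M ^ j).trace (M ^ k).trace = 0 :=
  hM.repBracket_trace_eq_zero (exists_traceField_pow M j 1 (Commute.one_left M))
    fun _ h => map_pow_derivation_eq_zero h k

theorem HasQuadraticBracket.repBracket_trace_zpow {M : Matrix (Fin n) (Fin n) (RepRing n L)}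
    (hM : HasQuadraticBracket M) (hu : IsUnit M.det) (j k : ℤ) :
    repBracket (M ^ j).trace (M ^ k).trace = 0 :=
  hM.repBracket_trace_eq_zero (exists_traceField_zpow M hu j)
    fun _ h => map_zpow_derivation_eq_zero hu h k

theorem map_matrix_pow {R S : Type*} [CommRing R] [CommRing S] (φ : R →+* S)
    (M : Matrix (Fin n) (Fin n) R) (k : ℕ) : (M ^ k).map φ = M.map φ ^ k :=
  map_pow φ.mapMatrix M k

theorem map_matrix_zpow {R S : Type*} [CommRing R] [CommRing S] (φ : R →+* S)
    {M : Matrix (Fin n) (Fin n) R} (hM : IsUnit M.det) (k : ℤ) : (M ^ k).map φ = M.map φ ^ k := by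
  cases k with
  | ofNat k =>
    rw [Int.ofNat_eq_natCast, _root_.zpow_natCast, _root_.zpow_natCast, map_matrix_pow]
  | negSucc k =>
    rw [_root_.zpow_negSucc, _root_.zpow_negSucc,
      map_nonsing_inv φ _ (by rw [Matrix.det_pow]; exact hM.pow _), map_matrix_pow]

variable {q₀ : ℂˣ}

theorem poissonBracket_traceFun_eq_zero
    {A B : Matrix (Fin n) (Fin n) (RepRing n L ⧸ repIdeal n L q₀)} (hA : IsEquivariant A)
    (hB : IsEquivariant B) (M N : Matrix (Fin n) (Fin n) (RepRing n L))
    (hM : M.map (Ideal.Quotient.mk (repIdeal n L q₀)) = A)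
    (hN : N.map (Ideal.Quotient.mk (repIdeal n L q₀)) = B)
    (h : repBracket M.trace N.trace = 0) :
    poissonBracket (traceFun A hA) (traceFun B hB) = 0 := by
  subst hM hN
  apply Subtype.ext
  rw [poissonBracket_mk _ _ M.trace N.trace (map_sum _ _ _) (map_sum _ _ _), h, map_zero]
  rfl

theorem isUnit_det_matX_coord : IsUnit (matX (coord n .invX)).det := by
  have h := isUnit_denAt (n := n) (L := .invX)
  simp only [denAt, IsUnit.mul_iff] at h
  exact h.2

theorem isUnit_det_Y_add_X_inv_coord :
    IsUnit (matY (coord n .invX) + (matX (coord n .invX))⁻¹).det := by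
  have h : 1 + matX (coord n .invX) * matY (coord n .invX) =
      matX (coord n .invX) * (matY (coord n .invX) + (matX (coord n .invX))⁻¹) := by
    rw [Matrix.mul_add, Matrix.mul_nonsing_inv _ isUnit_det_matX_coord, add_comm]
  have h2 := (isUnit_factors (n := n) (L := .invX)).1
  rw [h, Matrix.det_mul, IsUnit.mul_iff] at h2
  exact h2.2

theorem map_mk_one_add_XY_zpow (j : ℤ) :
    ((1 + 𝐗 * 𝐘) ^ j).map (Ideal.Quotient.mk (repIdeal n L q₀)) =
      (1 + matX (cmCoord n L q₀) * matY (cmCoord n L q₀)) ^ j := by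
  rw [map_matrix_zpow _ isUnit_factors.1, map_one_add_mul]
  rfl

theorem map_mk_Y_add_X_inv_zpow (j : ℤ) :
    ((matY (coord n .invX) + (matX (coord n .invX))⁻¹) ^ j).map
        (Ideal.Quotient.mk (repIdeal n .invX q₀)) =
      (matY (cmCoord n .invX q₀) + (matX (cmCoord n .invX q₀))⁻¹) ^ j := by
  rw [map_matrix_zpow _ isUnit_det_Y_add_X_inv_coord, Matrix.map_add _ (map_add _),
    map_nonsing_inv _ _ isUnit_det_matX_coord]
  rfl

end TadpoleCM

theorem theorem3p3 (n : ℕ) (q₀ : ℂˣ) :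
    (∀ j k : ℕ,
      TadpoleCM.poissonBracket (TadpoleCM.trX n q₀ j) (TadpoleCM.trX n q₀ k) = 0) ∧
    (∀ j k : ℕ,
      TadpoleCM.poissonBracket (TadpoleCM.trY n q₀ j) (TadpoleCM.trY n q₀ k) = 0) ∧
    (∀ j k : ℤ,
      TadpoleCM.poissonBracket (TadpoleCM.trOneAddXY n q₀ j) (TadpoleCM.trOneAddXY n q₀ k) = 0) ∧
    (∀ j k : ℤ,
      TadpoleCM.poissonBracket (TadpoleCM.trYAddXInv n q₀ j) (TadpoleCM.trYAddXInv n q₀ k) = 0) :=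
  ⟨fun j k => TadpoleCM.poissonBracket_traceFun_eq_zero _ _ _ _
      (TadpoleCM.map_matrix_pow _ _ j) (TadpoleCM.map_matrix_pow _ _ k)
      (TadpoleCM.hasQuadraticBracket_X.repBracket_trace_pow j k),
    fun j k => TadpoleCM.poissonBracket_traceFun_eq_zero _ _ _ _
      (TadpoleCM.map_matrix_pow _ _ j) (TadpoleCM.map_matrix_pow _ _ k)
      (TadpoleCM.hasQuadraticBracket_Y.repBracket_trace_pow j k),
    fun j k => TadpoleCM.poissonBracket_traceFun_eq_zero _ _ _ _
      (TadpoleCM.map_mk_one_add_XY_zpow j) (TadpoleCM.map_mk_one_add_XY_zpow k)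
      (TadpoleCM.hasQuadraticBracket_one_add_XY.repBracket_trace_zpow
        TadpoleCM.isUnit_factors.1 j k),
    fun j k => TadpoleCM.poissonBracket_traceFun_eq_zero _ _ _ _
      (TadpoleCM.map_mk_Y_add_X_inv_zpow j) (TadpoleCM.map_mk_Y_add_X_inv_zpow k)
      ((TadpoleCM.hasQuadraticBracket_Y_add_X_inv
        TadpoleCM.isUnit_det_matX_coord).repBracket_trace_zpow
          TadpoleCM.isUnit_det_Y_add_X_inv_coord j k)⟩
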